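/- Let $S=\mathbb{A}^1_{\mathbb{C}}\setminus\mu_3=\operatorname{Spec}A$ with $A=\mathbb{C}[t,\tfrac1{1-t^3}]$, where $\mu_3$ is the group of cubic roots of unity, and let $U\subset\mathbb{P}^2_S$ be the Hesse family of cubic curves over $S$, defined by $$x_0^3+y_0^3+z_0^3=3t\,x_0y_0z_0 ,$$ with affine equation $x^3+y^3+1=3txy$, where $x=x_0/z_0$, $y=y_0/z_0$. Consider the relative differential forms $$\omega_t=\frac{dy}{x^2-ty}=\frac{-dx}{y^2-tx},\qquad \eta_t=xy\,\omega_t .$$ The form $\omega_t$ is regular on $U$. The form $\eta_t$ is regular on $z_0\neq 0$ and of the second kind: $\eta_t-d(y^2/x)$ is regular on $x_0\neq0$. They therefore define classes $[\omega_t],[\eta_t]$ in the relative de Rham cohomology $\mathscr{H}^1_{\rm dR}(U/S)$ (as $S$ is affine, this is identified with its $A$-module of global sections). Let $$\nabla\colon \mathscr{H}^1_{\rm dR}(U/S)\to\Omega^1_{S/\mathbb{C}}\otimes_{\mathscr{O}_S}\mathscr{H}^1_{\rm dR}(U/S)$$ be the Gauss–Manin connection, i.e. the connecting homomorphism of the exact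 sequence of complexes $0\to f^*\Omega^1_{S/\mathbb{C}}\otimes\Omega^{\bullet-1}_{U/S}\to\Omega^\bullet_{U/\mathbb{C}}\to\Omega^\bullet_{U/S}\to0$, where $f\colon U\to S$ is the projection; it is additive and satisfies $\nabla(ac)=da\otimes c+a\nabla c$. Then $[\omega_t],[\eta_t]$ is a basis of $\mathscr{H}^1_{\rm dR}(U/S)$ over $\mathscr{O}_S$, and $$\nabla\begin{pmatrix}[\omega_t]&[\eta_t]\end{pmatrix}=\frac{dt}{1-t^3}\otimes\begin{pmatrix}[\omega_t]&[\eta_t]\end{pmatrix}\begin{pmatrix}t^2&t\\-1&-t^2\end{pmatrix},$$ that is, $\nabla[\omega_t]=\frac{dt}{1-t^3}\otimes(t^2[\omega_t]-[\eta_t])$ and $\nabla[\eta_t]=\frac{dt}{1-t^3}\otimes(t[\omega_t]-t^2[\eta_t])$. -/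

import Mathlib

open scoped TensorProduct KaehlerDifferential

noncomputable section

namespace CechDeRham

section ExteriorDerivative

variable (R B : Type*) [CommRing R] [CommRing B] [Algebra R B]

/-- The module `Ω²_{B/R}` of Kähler 2-forms. -/
abbrev TwoForms : Type _ := ⋀[B]^2 Ω[B⁄R]

variable {R B}

/-- The wedge product `α ∧ β` of two 1-forms. -/
def wedge (α β : Ω[B⁄R]) : TwoForms R B := exteriorPower.ιMulti B 2 ![α, β]

theorem update_pair_zero {M : Type*} (a b x : M) : Function.update ![a, b] 0 x = ![x, b] := by
  ext i; fin_cases i <;> rfl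

theorem update_pair_one {M : Type*} (a b x : M) : Function.update ![a, b] 1 x = ![a, x] := by
  ext i; fin_cases i <;> rfl

theorem wedge_add_left (α α' β : Ω[B⁄R]) : wedge (α + α') β = wedge α β + wedge α' β := by
  have h := (exteriorPower.ιMulti B 2 (M := Ω[B⁄R])).map_update_add ![α, β] 0 α α'
  rwa [update_pair_zero, update_pair_zero, update_pair_zero] at h

theorem wedge_smul_left (b : B) (α β : Ω[B⁄R]) : wedge (b • α) β = b • wedge α β := by
  have h := (exteriorPower.ιMulti B 2 (M := Ω[B⁄R])).map_update_smul ![α, β] 0 b α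
  rwa [update_pair_zero, update_pair_zero] at h

theorem wedge_self (α : Ω[B⁄R]) : wedge α α = 0 :=
  (exteriorPower.ιMulti B 2 (M := Ω[B⁄R])).map_eq_zero_of_eq ![α, α] (i := 0) (j := 1)
    (by simp) (by simp)

theorem wedge_add_right (α β β' : Ω[B⁄R]) : wedge α (β + β') = wedge α β + wedge α β' := by
  have h := (exteriorPower.ιMulti B 2 (M := Ω[B⁄R])).map_update_add ![α, β] 1 β β'
  rwa [update_pair_one, update_pair_one, update_pair_one] at h

theorem wedge_smul_right (b : B) (α β : Ω[B⁄R]) : wedge α (b • β) = b • wedge α β := by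
  have h := (exteriorPower.ιMulti B 2 (M := Ω[B⁄R])).map_update_smul ![α, β] 1 b β
  rwa [update_pair_one, update_pair_one] at h

theorem wedge_swap (α β : Ω[B⁄R]) : wedge α β = - wedge β α := by
  have h := wedge_self (α + β)
  rw [wedge_add_left, wedge_add_right, wedge_add_right, wedge_self, wedge_self, zero_add,
    add_zero] at h
  exact eq_neg_of_add_eq_zero_left h

variable (R) in
/-- The `R`-linear map `a ↦ da ∧ db` for a fixed `b`. -/
def dWedgeD (b : B) : B →ₗ[R] TwoForms R B where
  toFun a := wedge (KaehlerDifferential.D R B a) (KaehlerDifferential.D R B b)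
  map_add' a a' := by rw [map_add, wedge_add_left]
  map_smul' r a := by
    rw [Derivation.map_smul, ← algebraMap_smul B r, wedge_smul_left, algebraMap_smul]
    rfl

variable (R B) in
/-- The map `∑ aᵢ [bᵢ] ↦ ∑ daᵢ ∧ dbᵢ` on formal sums. -/
def preExtDeriv : (B →₀ B) →ₗ[R] TwoForms R B := Finsupp.lsum ℕ (dWedgeD R)

theorem preExtDeriv_single (a b : B) : preExtDeriv R B (Finsupp.single b a) =
    wedge (KaehlerDifferential.D R B a) (KaehlerDifferential.D R B b) := by
  rw [preExtDeriv, Finsupp.lsum_single]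
  rfl

theorem preExtDeriv_kerTotal :
    (KaehlerDifferential.kerTotal R B).restrictScalars R ≤ LinearMap.ker (preExtDeriv R B) := by
  intro v hv
  rw [Submodule.restrictScalars_mem] at hv
  rw [LinearMap.mem_ker]
  refine Submodule.closure_induction (p := fun v _ => preExtDeriv R B v = 0) (by simp)
    (fun x y _ _ hx hy => by rw [map_add, hx, hy, add_zero]) ?_ hv
  intro r v hv
  obtain ((⟨⟨x, y⟩, rfl⟩ | ⟨⟨x, y⟩, rfl⟩) | ⟨x, rfl⟩) := hv
  · simp only [smul_sub, smul_add, Finsupp.smul_single, map_sub, map_add, preExtDeriv_single,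
      wedge_add_right, sub_self]
  · simp only [smul_sub, smul_add, Finsupp.smul_single, map_sub, map_add, preExtDeriv_single,
      smul_eq_mul, mul_one, Derivation.leibniz, wedge_add_right, wedge_add_left,
      wedge_smul_right, wedge_smul_left]
    rw [wedge_swap (KaehlerDifferential.D R B y) (KaehlerDifferential.D R B x)]
    simp only [smul_neg]
    abel
  · simp only [Finsupp.smul_single, preExtDeriv_single, Derivation.map_algebraMap]
    rw [← zero_smul B (0 : Ω[B⁄R]), wedge_smul_right, zero_smul]

variable (R B) in
/-- The exterior derivative `d : Ω¹_{B/R} → Ω²_{B/R}`; it is the `R`-linear map determined by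
`d (a db) = da ∧ db`, see `extDeriv_smul_D`. -/
def extDeriv : Ω[B⁄R] →ₗ[R] TwoForms R B :=
  (((KaehlerDifferential.kerTotal R B).restrictScalars R).liftQ (preExtDeriv R B)
    preExtDeriv_kerTotal) ∘ₗ
  ((KaehlerDifferential.quotKerTotalEquiv R B).symm.toLinearMap.restrictScalars R)

theorem extDeriv_smul_D (a b : B) : extDeriv R B (a • KaehlerDifferential.D R B b) =
    wedge (KaehlerDifferential.D R B a) (KaehlerDifferential.D R B b) := by
  have h : (KaehlerDifferential.quotKerTotalEquiv R B).symm (a • KaehlerDifferential.D R B b) =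
      (KaehlerDifferential.kerTotal R B).mkQ (Finsupp.single b a) := by
    rw [LinearEquiv.symm_apply_eq]
    simp [KaehlerDifferential.quotKerTotalEquiv]
  rw [← preExtDeriv_single]
  exact congrArg (((KaehlerDifferential.kerTotal R B).restrictScalars R).liftQ (preExtDeriv R B)
    preExtDeriv_kerTotal) h

end ExteriorDerivative

section Pullback

variable {R B C : Type*} [CommRing R] [CommRing B] [CommRing C] [Algebra R B] [Algebra R C]

/-- The restriction (pullback) of 1-forms `Ω_{B/R} → Ω_{C/R}`, `a db ↦ ρ a d(ρ b)`, along an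
`R`-algebra homomorphism `ρ : B → C`. -/
def pullback (ρ : B →ₐ[R] C) : Ω[B⁄R] →ₗ[R] Ω[C⁄R] :=
  letI := ρ.toRingHom.toAlgebra
  haveI : IsScalarTower R B C := IsScalarTower.of_algebraMap_eq fun r => (ρ.commutes r).symm
  (KaehlerDifferential.map R R B C).restrictScalars R

theorem pullback_D (ρ : B →ₐ[R] C) (b : B) :
    pullback ρ (KaehlerDifferential.D R B b) = KaehlerDifferential.D R C (ρ b) := by
  let _ := ρ.toRingHom.toAlgebra
  have : IsScalarTower R B C := IsScalarTower.of_algebraMap_eq fun r => (ρ.commutes r).symm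
  exact KaehlerDifferential.map_D R R B C b

theorem pullback_smul (ρ : B →ₐ[R] C) (b : B) (α : Ω[B⁄R]) :
    pullback ρ (b • α) = ρ b • pullback ρ α := by
  let _ := ρ.toRingHom.toAlgebra
  have : IsScalarTower R B C := IsScalarTower.of_algebraMap_eq fun r => (ρ.commutes r).symm
  exact (KaehlerDifferential.map R R B C).map_smul b α

end Pullback

section Complex

/-! In this section `B₁`, `B₂`, `C` are `R`-algebras and `ρ₁ : B₁ → C`, `ρ₂ : B₂ → C` are
`R`-algebra homomorphisms. Geometrically, `U = Spec B₁ ∪ Spec B₂` is a separated scheme over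
`Spec R` with two affine charts, `Spec C` is their intersection and the `ρᵢ` are restriction of
functions. The hypercohomology of the de Rham complex `Ω^•_{U/R}` is computed by the total complex
of the Čech–de Rham double complex of this affine covering. -/

variable {R B₁ B₂ C : Type*} [CommRing R] [CommRing B₁] [CommRing B₂] [CommRing C]
  [Algebra R B₁] [Algebra R B₂] [Algebra R C]

variable (R B₁ B₂ C) in
/-- Total degree 1: 1-forms on both charts and a function on the intersection. -/
abbrev Cochain1 : Type _ := Ω[B₁⁄R] × Ω[B₂⁄R] × C

variable (R B₁ B₂ C) in
/-- Total degree 2: 2-forms on both charts and a 1-form on the intersection. -/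
abbrev Cochain2 : Type _ := TwoForms R B₁ × TwoForms R B₂ × Ω[C⁄R]

/-- The differential `(b₁, b₂) ↦ (db₁, db₂, b₂ - b₁)` in total degree 0. -/
def d0 (ρ₁ : B₁ →ₐ[R] C) (ρ₂ : B₂ →ₐ[R] C) : (B₁ × B₂) →ₗ[R] Cochain1 R B₁ B₂ C :=
  ((KaehlerDifferential.D R B₁).toLinearMap ∘ₗ LinearMap.fst R B₁ B₂).prod
    (((KaehlerDifferential.D R B₂).toLinearMap ∘ₗ LinearMap.snd R B₁ B₂).prod
      (ρ₂.toLinearMap ∘ₗ LinearMap.snd R B₁ B₂ - ρ₁.toLinearMap ∘ₗ LinearMap.fst R B₁ B₂))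

theorem d0_apply (ρ₁ : B₁ →ₐ[R] C) (ρ₂ : B₂ →ₐ[R] C) (b₁ : B₁) (b₂ : B₂) :
    d0 ρ₁ ρ₂ (b₁, b₂) =
      (KaehlerDifferential.D R B₁ b₁, KaehlerDifferential.D R B₂ b₂, ρ₂ b₂ - ρ₁ b₁) := rfl

/-- The differential `(α₁, α₂, f) ↦ (dα₁, dα₂, α₂ - α₁ - df)` in total degree 1. -/
def d1 (ρ₁ : B₁ →ₐ[R] C) (ρ₂ : B₂ →ₐ[R] C) :
    Cochain1 R B₁ B₂ C →ₗ[R] Cochain2 R B₁ B₂ C :=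
  (extDeriv R B₁ ∘ₗ LinearMap.fst R _ _).prod
    ((extDeriv R B₂ ∘ₗ LinearMap.fst R _ _ ∘ₗ LinearMap.snd R _ _).prod
      (pullback ρ₂ ∘ₗ LinearMap.fst R _ _ ∘ₗ LinearMap.snd R _ _ -
        pullback ρ₁ ∘ₗ LinearMap.fst R _ _ -
        (KaehlerDifferential.D R C).toLinearMap ∘ₗ LinearMap.snd R _ _ ∘ₗ LinearMap.snd R _ _))

theorem d1_apply (ρ₁ : B₁ →ₐ[R] C) (ρ₂ : B₂ →ₐ[R] C) (α₁ : Ω[B₁⁄R]) (α₂ : Ω[B₂⁄R]) (f : C) :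
    d1 ρ₁ ρ₂ (α₁, α₂, f) =
      (extDeriv R B₁ α₁, extDeriv R B₂ α₂,
        pullback ρ₂ α₂ - pullback ρ₁ α₁ - KaehlerDifferential.D R C f) := rfl

/-- The 1-cocycles. -/
abbrev Cocycle1 (ρ₁ : B₁ →ₐ[R] C) (ρ₂ : B₂ →ₐ[R] C) : Submodule R (Cochain1 R B₁ B₂ C) :=
  LinearMap.ker (d1 ρ₁ ρ₂)

/-- The de Rham cohomology `H¹_dR(U/R)`: 1-cocycles modulo coboundaries. -/
abbrev H1dR (ρ₁ : B₁ →ₐ[R] C) (ρ₂ : B₂ →ₐ[R] C) : Type _ :=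
  Cocycle1 ρ₁ ρ₂ ⧸ (LinearMap.range (d0 ρ₁ ρ₂)).submoduleOf (Cocycle1 ρ₁ ρ₂)

/-- The cohomology class of a 1-cocycle. -/
def cohomologyClass (ρ₁ : B₁ →ₐ[R] C) (ρ₂ : B₂ →ₐ[R] C) :
    Cocycle1 ρ₁ ρ₂ →ₗ[R] H1dR ρ₁ ρ₂ :=
  Submodule.mkQ _

end Complex

section GaussManin

/-! Now `k → A` is a ring homomorphism and `B₁`, `B₂`, `C` are `A`-algebras as above, so that
`U → S = Spec A` is a morphism of `k`-schemes. -/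

variable {k A B₁ B₂ C : Type*} [CommRing k] [CommRing A] [CommRing B₁] [CommRing B₂] [CommRing C]
  [Algebra k A] [Algebra k B₁] [Algebra k B₂] [Algebra k C]
  [Algebra A B₁] [Algebra A B₂] [Algebra A C]
  [IsScalarTower k A B₁] [IsScalarTower k A B₂] [IsScalarTower k A C]

variable (k A B₁ B₂ C) in
/-- The projection `Ω^•_{U/k} → Ω^•_{U/S}` in total degree 1. -/
def toRelative (w : Cochain1 k B₁ B₂ C) : Cochain1 A B₁ B₂ C :=
  (KaehlerDifferential.map k A B₁ B₁ w.1, KaehlerDifferential.map k A B₂ B₂ w.2.1, w.2.2)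

/-- For `θ ∈ Ω¹_{S/k}`, the map `θ ∧ -` from total degree 1 to total degree 2,
`(β₁, β₂, g) ↦ (θ ∧ β₁, θ ∧ β₂, -g θ)`. Since the 1-form `θ` is moved past a differential, its
sign on the function `g` in Čech degree 1 is the one for which cocycles go to cocycles. -/
def baseWedge (θ : Ω[A⁄k]) (w : Cochain1 k B₁ B₂ C) : Cochain2 k B₁ B₂ C :=
  (wedge (KaehlerDifferential.map k k A B₁ θ) w.1,
    wedge (KaehlerDifferential.map k k A B₂ θ) w.2.1,
    -(w.2.2 • KaehlerDifferential.map k k A C θ))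

variable (k) in
/-- The graph of the Gauss–Manin connection `∇ : H¹_dR(U/S) → Ω¹_{S/k} ⊗ H¹_dR(U/S)`, that is, of
the connecting homomorphism of the short exact sequence of complexes
`0 → f^*Ω¹_S ⊗ Ω^{•-1}_{U/S} → Ω^•_U / (image of f^*Ω²_S ⊗ Ω^{•-2}_U) → Ω^•_{U/S} → 0`
attached to a smooth morphism `f : U → S`:
a relative cocycle `z` representing `c` is lifted to an absolute cochain `zt`, the differential of
`zt` is written as `∑ θᵢ ∧ wᵢ` with relative cocycles `wᵢ` (lifted to absolute cochains `wtᵢ`),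
and `s = ∑ θᵢ ⊗ [wᵢ]`. -/
def IsGaussManin (ρ₁ : B₁ →ₐ[A] C) (ρ₂ : B₂ →ₐ[A] C)
    (c : H1dR ρ₁ ρ₂) (s : Ω[A⁄k] ⊗[A] H1dR ρ₁ ρ₂) : Prop :=
  ∃ (z : Cocycle1 ρ₁ ρ₂) (zt : Cochain1 k B₁ B₂ C) (n : ℕ) (θ : Fin n → Ω[A⁄k])
    (w : Fin n → Cocycle1 ρ₁ ρ₂) (wt : Fin n → Cochain1 k B₁ B₂ C),
    cohomologyClass ρ₁ ρ₂ z = c ∧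
    toRelative k A B₁ B₂ C zt = z ∧
    (∀ i, toRelative k A B₁ B₂ C (wt i) = w i) ∧
    d1 (ρ₁.restrictScalars k) (ρ₂.restrictScalars k) zt = ∑ i, baseWedge (θ i) (wt i) ∧
    s = ∑ i, θ i ⊗ₜ[A] cohomologyClass ρ₁ ρ₂ (w i)

end GaussManin

end CechDeRham

namespace HesseFamily

open CechDeRham

/-- The coordinate ring `A = ℂ[t, 1 / (1 - t³)]` of `S = 𝔸¹ - μ₃`. -/
def Base : Type := Localization.Away (1 - Polynomial.X ^ 3 : Polynomial ℂ)

instance : CommRing Base :=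
  inferInstanceAs (CommRing (Localization.Away (1 - Polynomial.X ^ 3 : Polynomial ℂ)))

instance : Algebra (Polynomial ℂ) Base :=
  inferInstanceAs (Algebra (Polynomial ℂ) (Localization.Away (1 - Polynomial.X ^ 3 : Polynomial ℂ)))

instance : IsLocalization.Away (1 - Polynomial.X ^ 3 : Polynomial ℂ) Base :=
  inferInstanceAs (IsLocalization.Away (1 - Polynomial.X ^ 3 : Polynomial ℂ)
    (Localization.Away (1 - Polynomial.X ^ 3 : Polynomial ℂ)))

instance : Algebra ℂ Base :=
  inferInstanceAs (Algebra ℂ (Localization.Away (1 - Polynomial.X ^ 3 : Polynomial ℂ)))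

instance : IsScalarTower ℂ (Polynomial ℂ) Base :=
  inferInstanceAs (IsScalarTower ℂ (Polynomial ℂ)
    (Localization.Away (1 - Polynomial.X ^ 3 : Polynomial ℂ)))

/-- The coordinate `t` on `S`. -/
def t : Base := algebraMap (Polynomial ℂ) Base Polynomial.X

/-- The function `1 / (1 - t³)` on `S`. -/
def invDisc : Base := IsLocalization.Away.invSelf (1 - Polynomial.X ^ 3 : Polynomial ℂ)

theorem disc_mul_invDisc : (1 - t ^ 3) * invDisc = 1 := by
  have h := IsLocalization.Away.mul_invSelf (S := Base) (1 - Polynomial.X ^ 3 : Polynomial ℂ)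
  rwa [map_sub, map_one, map_pow] at h

/-- The polynomial `x³ + y³ + 1 - 3txy` in `A[x][y]`. -/
def hessePoly : Polynomial (Polynomial Base) :=
  Polynomial.C Polynomial.X ^ 3 + Polynomial.X ^ 3 + 1
    - 3 * Polynomial.C (Polynomial.C t) * Polynomial.C Polynomial.X * Polynomial.X

/-- The ring `B = A[x, y] / (x³ + y³ + 1 - 3txy)`. It is the coordinate ring of the chart `z₀ ≠ 0`
of `U = {x₀³ + y₀³ + z₀³ = 3t x₀y₀z₀} ⊂ ℙ²_S`, with `x = x₀ / z₀` and `y = y₀ / z₀`. By the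
symmetry of the equation it is also the coordinate ring of the chart `x₀ ≠ 0`, where the two
generators are `u = z₀ / x₀` and `v = y₀ / x₀`. These two charts cover `U`, since `x₀ = z₀ = 0`
and the equation force `y₀ = 0`. -/
def Chart : Type := AdjoinRoot hessePoly

instance : CommRing Chart := inferInstanceAs (CommRing (AdjoinRoot hessePoly))

instance : Algebra Base Chart := inferInstanceAs (Algebra Base (AdjoinRoot hessePoly))

instance : Algebra ℂ Chart := inferInstanceAs (Algebra ℂ (AdjoinRoot hessePoly))

instance : IsScalarTower ℂ Base Chart :=
  inferInstanceAs (IsScalarTower ℂ Base (AdjoinRoot hessePoly))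

/-- The first generator of `B`: `x` on the chart `z₀ ≠ 0`, `u` on the chart `x₀ ≠ 0`. -/
def x : Chart := AdjoinRoot.of hessePoly Polynomial.X

/-- The second generator of `B`: `y` on the chart `z₀ ≠ 0`, `v` on the chart `x₀ ≠ 0`. -/
def y : Chart := AdjoinRoot.root hessePoly

/-- The function `t` on a chart. -/
abbrev tc : Chart := algebraMap Base Chart t

theorem chart_relation : x ^ 3 + y ^ 3 + 1 = 3 * tc * x * y := by
  have h : Polynomial.eval₂ (AdjoinRoot.of hessePoly) (AdjoinRoot.root hessePoly)
      (Polynomial.C Polynomial.X ^ 3 + Polynomial.X ^ 3 + 1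
        - 3 * Polynomial.C (Polynomial.C t) * Polynomial.C Polynomial.X * Polynomial.X) = 0 :=
    AdjoinRoot.eval₂_root hessePoly
  simp only [Polynomial.eval₂_sub, Polynomial.eval₂_add, Polynomial.eval₂_mul,
    Polynomial.eval₂_pow, Polynomial.eval₂_C, Polynomial.eval₂_X, Polynomial.eval₂_one,
    Polynomial.eval₂_ofNat] at h
  exact sub_eq_zero.mp h

theorem tc_invDisc : (1 - tc ^ 3) * algebraMap Base Chart invDisc = 1 := by
  have h := congrArg (algebraMap Base Chart) disc_mul_invDisc
  simpa only [map_mul, map_sub, map_one, map_pow] using h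

/-- The coordinate ring `B[1/x]` of the intersection of the two charts. -/
def Overlap : Type := Localization.Away x

instance : CommRing Overlap := inferInstanceAs (CommRing (Localization.Away x))

instance : Algebra Chart Overlap := inferInstanceAs (Algebra Chart (Localization.Away x))

instance : IsLocalization.Away x Overlap :=
  inferInstanceAs (IsLocalization.Away x (Localization.Away x))

instance : Algebra Base Overlap := inferInstanceAs (Algebra Base (Localization.Away x))

instance : Algebra ℂ Overlap := inferInstanceAs (Algebra ℂ (Localization.Away x))

instance : IsScalarTower Base Chart Overlap :=
  inferInstanceAs (IsScalarTower Base Chart (Localization.Away x))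

instance : IsScalarTower ℂ Base Overlap :=
  inferInstanceAs (IsScalarTower ℂ Base (Localization.Away x))

/-- The function `1 / x` on the intersection. -/
def xinv : Overlap := IsLocalization.Away.invSelf x

theorem x_mul_xinv : algebraMap Chart Overlap x * xinv = 1 :=
  IsLocalization.Away.mul_invSelf x

/-- Restriction from the chart `z₀ ≠ 0` to the intersection. -/
def res₁ : Chart →ₐ[Base] Overlap := IsScalarTower.toAlgHom Base Chart Overlap

theorem transition_relation :
    hessePoly.eval₂ (Polynomial.aeval (R := Base) xinv : Polynomial Base →ₐ[Base] Overlap)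
      (res₁ y * xinv) = 0 := by
  have h := congrArg res₁ chart_relation
  have h1 : res₁ x * xinv = 1 := x_mul_xinv
  simp only [map_add, map_mul, map_pow, map_one, map_ofNat, AlgHom.commutes] at h
  simp only [hessePoly, Polynomial.eval₂_sub, Polynomial.eval₂_add, Polynomial.eval₂_mul,
    Polynomial.eval₂_pow, Polynomial.eval₂_C, Polynomial.eval₂_X, Polynomial.eval₂_one,
    Polynomial.eval₂_ofNat, RingHom.coe_coe, Polynomial.aeval_X, Polynomial.aeval_C]
  linear_combination xinv ^ 3 * h - (1 + res₁ x * xinv + res₁ x ^ 2 * xinv ^ 2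
    - 3 * algebraMap Base Overlap t * res₁ y * xinv ^ 2) * h1

/-- Restriction from the chart `x₀ ≠ 0` to the intersection: `u ↦ 1 / x`, `v ↦ y / x`. -/
def res₂ : Chart →ₐ[Base] Overlap :=
  AdjoinRoot.liftAlgHom hessePoly (Polynomial.aeval xinv) (res₁ y * xinv) transition_relation

theorem res₂_x : res₂ x = xinv := by
  have h := AdjoinRoot.lift_of (i := (Polynomial.aeval (R := Base) xinv).toRingHom)
    transition_relation (x := Polynomial.X)
  exact h.trans (Polynomial.aeval_X xinv)

theorem res₂_y : res₂ y = res₁ y * xinv := by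
  exact AdjoinRoot.lift_root (i := (Polynomial.aeval (R := Base) xinv).toRingHom)
    transition_relation

/-- Coefficients with `coefA (x² - ty) + coefB (y² - tx) = 1 - t³`. -/
def coefA : Chart := tc ^ 2 * y ^ 2 - x * (1 + tc * x * y - tc ^ 3)

/-- See `coefA`. -/
def coefB : Chart := tc ^ 3 * y - y * (1 + tc * x * y - tc ^ 3)

theorem coef_relation :
    coefA * (x ^ 2 - tc * y) + coefB * (y ^ 2 - tc * x) = 1 - tc ^ 3 := by
  have h := chart_relation
  simp only [coefA, coefB]
  linear_combination (-(1 + tc * x * y - tc ^ 3)) * h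

/-- The relative form `ω` on the chart `z₀ ≠ 0`. It is `dy / (x² - ty) = -dx / (y² - tx)`: see
`omega_dy`, `omega_dx` and `omega_unique`. -/
def omega : Ω[Chart⁄Base] :=
  algebraMap Base Chart invDisc •
    (coefA • KaehlerDifferential.D Base Chart y - coefB • KaehlerDifferential.D Base Chart x)

theorem differential_relation :
    (x ^ 2 - tc * y) • KaehlerDifferential.D Base Chart x +
      (y ^ 2 - tc * x) • KaehlerDifferential.D Base Chart y = 0 := by
  have h3 : algebraMap Base Chart (algebraMap ℂ Base 3⁻¹) * 3 = 1 := by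
    rw [← map_ofNat (algebraMap Base Chart) 3, ← map_ofNat (algebraMap ℂ Base) 3, ← map_mul,
      ← map_mul]
    norm_num
  have h : KaehlerDifferential.D Base Chart (x ^ 3 + y ^ 3 + 1) =
      KaehlerDifferential.D Base Chart (algebraMap Base Chart (3 * t) * (x * y)) := by
    have e : 3 * tc * x * y = algebraMap Base Chart (3 * t) * (x * y) := by
      rw [map_mul, map_ofNat]
      ring
    rw [chart_relation, e]
  simp only [map_add, Derivation.leibniz_pow, Derivation.map_one_eq_zero, Derivation.leibniz,
    Derivation.map_algebraMap, smul_zero, add_zero] at h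
  have h' : (3 : Chart) • ((x ^ 2 - tc * y) • KaehlerDifferential.D Base Chart x +
      (y ^ 2 - tc * x) • KaehlerDifferential.D Base Chart y) = 0 := by
    rw [← sub_eq_zero] at h
    rw [← h, map_mul, map_ofNat]
    simp only [← Nat.cast_smul_eq_nsmul Chart]
    push_cast
    module
  rw [← one_smul Chart (_ + _), ← h3, mul_smul, h', smul_zero]

theorem omega_dy : (x ^ 2 - tc * y) • omega = KaehlerDifferential.D Base Chart y := by
  have h := differential_relation
  have h1 : (x ^ 2 - tc * y) • omega =
      (algebraMap Base Chart invDisc *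
        (coefA * (x ^ 2 - tc * y) + coefB * (y ^ 2 - tc * x))) •
          KaehlerDifferential.D Base Chart y
      - (algebraMap Base Chart invDisc * coefB) •
        ((x ^ 2 - tc * y) • KaehlerDifferential.D Base Chart x +
          (y ^ 2 - tc * x) • KaehlerDifferential.D Base Chart y) := by
    rw [omega]; module
  rw [h1, h, coef_relation, mul_comm, tc_invDisc, one_smul, smul_zero, sub_zero]

theorem omega_dx : (y ^ 2 - tc * x) • omega = -KaehlerDifferential.D Base Chart x := by
  have h := differential_relation
  have h1 : (y ^ 2 - tc * x) • omega =
      -((algebraMap Base Chart invDisc *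
        (coefA * (x ^ 2 - tc * y) + coefB * (y ^ 2 - tc * x))) •
          KaehlerDifferential.D Base Chart x)
      + (algebraMap Base Chart invDisc * coefA) •
        ((x ^ 2 - tc * y) • KaehlerDifferential.D Base Chart x +
          (y ^ 2 - tc * x) • KaehlerDifferential.D Base Chart y) := by
    rw [omega]; module
  rw [h1, h, coef_relation, mul_comm, tc_invDisc, one_smul, smul_zero, add_zero]

theorem eq_of_smul_eq {M : Type*} [AddCommGroup M] [Module Chart M] {α β : M}
    (hp : (x ^ 2 - tc * y) • α = (x ^ 2 - tc * y) • β)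
    (hq : (y ^ 2 - tc * x) • α = (y ^ 2 - tc * x) • β) : α = β := by
  have key : ∀ γ : M, γ = (algebraMap Base Chart invDisc * coefA) • ((x ^ 2 - tc * y) • γ) +
      (algebraMap Base Chart invDisc * coefB) • ((y ^ 2 - tc * x) • γ) := by
    intro γ
    rw [smul_smul, smul_smul, ← add_smul, mul_assoc, mul_assoc, ← mul_add, coef_relation,
      mul_comm, tc_invDisc, one_smul]
  rw [key α, key β, hp, hq]

theorem omega_unique (α : Ω[Chart⁄Base])
    (hy : (x ^ 2 - tc * y) • α = KaehlerDifferential.D Base Chart y)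
    (hx : (y ^ 2 - tc * x) • α = -KaehlerDifferential.D Base Chart x) : α = omega :=
  eq_of_smul_eq (hy.trans omega_dy.symm) (hx.trans omega_dx.symm)

theorem D_mem_span_omega (b : Chart) :
    ∃ c : Chart, KaehlerDifferential.D Base Chart b = c • omega := by
  have hx : ∃ c : Chart, KaehlerDifferential.D Base Chart x = c • omega :=
    ⟨-(y ^ 2 - tc * x), by rw [neg_smul, omega_dx, neg_neg]⟩
  have hy : ∃ c : Chart, KaehlerDifferential.D Base Chart y = c • omega := ⟨_, omega_dy.symm⟩
  have hadd : ∀ a b : Chart, (∃ c : Chart, KaehlerDifferential.D Base Chart a = c • omega) →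
      (∃ c : Chart, KaehlerDifferential.D Base Chart b = c • omega) →
      ∃ c : Chart, KaehlerDifferential.D Base Chart (a + b) = c • omega := by
    rintro a b ⟨c, hc⟩ ⟨e, he⟩
    exact ⟨c + e, by rw [map_add, hc, he, add_smul]⟩
  have hmul : ∀ a b : Chart, (∃ c : Chart, KaehlerDifferential.D Base Chart a = c • omega) →
      (∃ c : Chart, KaehlerDifferential.D Base Chart b = c • omega) →
      ∃ c : Chart, KaehlerDifferential.D Base Chart (a * b) = c • omega := by
    rintro a b ⟨c, hc⟩ ⟨e, he⟩
    exact ⟨a * e + b * c, by rw [Derivation.leibniz, hc, he]; module⟩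
  have hpow : ∀ (a : Chart) (n : ℕ),
      (∃ c : Chart, KaehlerDifferential.D Base Chart a = c • omega) →
      ∃ c : Chart, KaehlerDifferential.D Base Chart (a ^ n) = c • omega := by
    intro a n ha
    induction n with
    | zero => exact ⟨0, by rw [pow_zero, Derivation.map_one_eq_zero, zero_smul]⟩
    | succ n ih =>
      have e : a ^ (n + 1) = a ^ n * a := pow_succ a n
      obtain ⟨c, hc⟩ := hmul _ _ ih ha
      exact ⟨c, by rw [e, hc]⟩
  have hof : ∀ p : Polynomial Base,
      ∃ c : Chart, KaehlerDifferential.D Base Chart (AdjoinRoot.of hessePoly p) = c • omega := by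
    intro p
    induction p using Polynomial.induction_on' with
    | add p q hp hq => rw [map_add]; exact hadd _ _ hp hq
    | monomial n a =>
      rw [← Polynomial.C_mul_X_pow_eq_monomial, map_mul, map_pow]
      refine hmul _ _ ⟨0, ?_⟩ (hpow _ n hx)
      rw [zero_smul]
      exact Derivation.map_algebraMap (KaehlerDifferential.D Base Chart) a
  induction b using AdjoinRoot.induction_on with
  | ih p =>
    induction p using Polynomial.induction_on' with
    | add p q hp hq => rw [map_add]; exact hadd _ _ hp hq
    | monomial n a =>
      rw [← Polynomial.C_mul_X_pow_eq_monomial, map_mul, map_pow, AdjoinRoot.mk_C,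
        AdjoinRoot.mk_X]
      exact hmul _ _ (hof a) (hpow _ n hy)

/-- All relative 1-forms are closed, as the fibres are curves. -/
theorem extDeriv_eq_zero (α : Ω[Chart⁄Base]) : extDeriv Base Chart α = 0 := by
  have h : α ∈ Submodule.span Chart (Set.range (KaehlerDifferential.D Base Chart)) := by
    rw [KaehlerDifferential.span_range_derivation]; trivial
  refine Submodule.closure_induction (p := fun α _ => extDeriv Base Chart α = 0) (map_zero _)
    (fun α β _ _ hα hβ => by rw [map_add, hα, hβ, add_zero]) ?_ h
  intro a α hα
  obtain ⟨b, rfl⟩ := hα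
  obtain ⟨c, hc⟩ := D_mem_span_omega a
  obtain ⟨e, he⟩ := D_mem_span_omega b
  rw [extDeriv_smul_D, hc, he, wedge_smul_left, wedge_smul_right, wedge_self, smul_zero, smul_zero]

theorem eq_zero_of_res₂ (γ : Ω[Overlap⁄Base]) (hp : res₂ (x ^ 2 - tc * y) • γ = 0)
    (hq : res₂ (y ^ 2 - tc * x) • γ = 0) : γ = 0 := by
  have key : γ = res₂ (algebraMap Base Chart invDisc * coefA) • (res₂ (x ^ 2 - tc * y) • γ) +
      res₂ (algebraMap Base Chart invDisc * coefB) • (res₂ (y ^ 2 - tc * x) • γ) := by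
    rw [smul_smul, smul_smul, ← add_smul, ← map_mul, ← map_mul, ← map_add, mul_assoc, mul_assoc,
      ← mul_add, coef_relation, mul_comm, tc_invDisc, map_one, one_smul]
  rw [key, hp, hq, smul_zero, smul_zero, add_zero]

theorem D_xinv : KaehlerDifferential.D Base Overlap xinv =
    -(xinv ^ 2 • KaehlerDifferential.D Base Overlap (res₁ x)) := by
  have h1 : res₁ x * xinv = 1 := x_mul_xinv
  have h := congrArg (KaehlerDifferential.D Base Overlap) h1
  rw [Derivation.leibniz, Derivation.map_one_eq_zero] at h
  have h2 : KaehlerDifferential.D Base Overlap xinv =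
      xinv • (res₁ x • KaehlerDifferential.D Base Overlap xinv) := by
    rw [smul_smul, mul_comm, h1, one_smul]
  rw [h2, eq_neg_of_add_eq_zero_left h, smul_neg, smul_smul, sq]

/-- In terms of `u` and `v`, the form `ω` is `du / (v² - tu) = -dv / (u² - tv)`. -/
theorem res₂_omega : pullback res₂ omega = -pullback res₁ omega := by
  have h1 : res₁ x * xinv = 1 := x_mul_xinv
  have hr := congrArg res₁ chart_relation
  simp only [map_add, map_mul, map_pow, map_one, map_ofNat, AlgHom.commutes] at hr
  have hp : (res₁ x ^ 2 - algebraMap Base Overlap t * res₁ y) • pullback res₁ omega =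
      KaehlerDifferential.D Base Overlap (res₁ y) := by
    rw [← pullback_D, ← omega_dy, pullback_smul]
    simp only [map_sub, map_mul, map_pow, AlgHom.commutes]
  have hq : (res₁ y ^ 2 - algebraMap Base Overlap t * res₁ x) • pullback res₁ omega =
      -KaehlerDifferential.D Base Overlap (res₁ x) := by
    rw [← pullback_D, ← map_neg, ← omega_dx, pullback_smul]
    simp only [map_sub, map_mul, map_pow, AlgHom.commutes]
  have hp2 : (xinv ^ 2 - algebraMap Base Overlap t * (res₁ y * xinv)) • pullback res₂ omega =
      KaehlerDifferential.D Base Overlap (res₁ y * xinv) := by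
    rw [← res₂_y, ← pullback_D, ← omega_dy, pullback_smul]
    simp only [map_sub, map_mul, map_pow, AlgHom.commutes, res₂_x]
  have hq2 : ((res₁ y * xinv) ^ 2 - algebraMap Base Overlap t * xinv) • pullback res₂ omega =
      -KaehlerDifferential.D Base Overlap xinv := by
    rw [← res₂_y, ← res₂_x, ← pullback_D, ← map_neg, ← omega_dx, pullback_smul]
    simp only [map_sub, map_mul, map_pow, AlgHom.commutes]
  rw [Derivation.leibniz, D_xinv, ← hp] at hp2
  rw [D_xinv] at hq2
  rw [eq_neg_iff_add_eq_zero]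
  refine eq_zero_of_res₂ _ ?_ ?_
  · simp only [map_sub, map_mul, map_pow, AlgHom.commutes, res₂_x, res₂_y]
    rw [smul_add, hp2, ← neg_neg (KaehlerDifferential.D Base Overlap (res₁ x)), ← hq]
    match_scalars
    linear_combination xinv ^ 2 * hr +
      (2 * res₁ y * xinv * algebraMap Base Overlap t - xinv * res₁ x ^ 2) * h1
  · simp only [map_sub, map_mul, map_pow, AlgHom.commutes, res₂_x, res₂_y]
    rw [smul_add, hq2, ← neg_neg (KaehlerDifferential.D Base Overlap (res₁ x)), ← hq]
    match_scalars
    linear_combination algebraMap Base Overlap t * xinv * h1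

/-- The cohomology `H¹_dR(U/S)` of the Hesse family, as an `A`-module. -/
abbrev HesseH1 : Type := H1dR res₁ res₂

theorem omegaCocycle_mem :
    ((omega, -omega, 0) : Cochain1 Base Chart Chart Overlap) ∈ Cocycle1 res₁ res₂ := by
  rw [LinearMap.mem_ker, d1_apply, extDeriv_eq_zero, extDeriv_eq_zero, map_neg, res₂_omega,
    neg_neg, sub_self, map_zero, sub_zero]
  rfl

/-- The global relative form `ω`, which is `omega` on the chart `z₀ ≠ 0` and, by symmetry and
`res₂_omega`, the form `-omega` on the chart `x₀ ≠ 0`. -/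
def omegaCocycle : Cocycle1 res₁ res₂ := ⟨(omega, -omega, 0), omegaCocycle_mem⟩

/-- The identity `η = x⁻³ η + d (y² / x)` for `η = xyω`. Here `x⁻³ η = u v ω` is regular on the
chart `x₀ ≠ 0`. -/
theorem eta_eq : pullback res₁ ((x * y) • omega) =
    pullback res₂ ((x * y) • (-omega)) +
      KaehlerDifferential.D Base Overlap (res₁ y ^ 2 * xinv) := by
  have h1 : res₁ x * xinv = 1 := x_mul_xinv
  have hr := congrArg res₁ chart_relation
  simp only [map_add, map_mul, map_pow, map_one, map_ofNat, AlgHom.commutes] at hr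
  have hp : (res₁ x ^ 2 - algebraMap Base Overlap t * res₁ y) • pullback res₁ omega =
      KaehlerDifferential.D Base Overlap (res₁ y) := by
    rw [← pullback_D, ← omega_dy, pullback_smul]
    simp only [map_sub, map_mul, map_pow, AlgHom.commutes]
  have hq : (res₁ y ^ 2 - algebraMap Base Overlap t * res₁ x) • pullback res₁ omega =
      -KaehlerDifferential.D Base Overlap (res₁ x) := by
    rw [← pullback_D, ← map_neg, ← omega_dx, pullback_smul]
    simp only [map_sub, map_mul, map_pow, AlgHom.commutes]
  rw [pullback_smul, pullback_smul, map_neg, res₂_omega, neg_neg, Derivation.leibniz, D_xinv, sq,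
    Derivation.leibniz, ← hp, ← neg_neg (KaehlerDifferential.D Base Overlap (res₁ x)), ← hq,
    map_mul, map_mul, res₂_x, res₂_y]
  match_scalars
  linear_combination (-(xinv ^ 2 * res₁ y)) * hr +
    (-(2 * algebraMap Base Overlap t * xinv * res₁ y ^ 2) +
      res₁ x * res₁ y * (res₁ x * xinv - 1)) * h1

theorem etaCocycle_mem :
    (((x * y) • omega, (x * y) • (-omega), -(res₁ y ^ 2 * xinv)) :
      Cochain1 Base Chart Chart Overlap) ∈ Cocycle1 res₁ res₂ := by
  rw [LinearMap.mem_ker, d1_apply, extDeriv_eq_zero, extDeriv_eq_zero, eta_eq, map_neg,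
    sub_neg_eq_add, sub_add_eq_sub_sub, sub_self, zero_sub, neg_add_cancel]
  rfl

/-- The cocycle of the form of the second kind `η = xyω`. It is the regular form `η` on the chart
`z₀ ≠ 0`; it has poles along `z₀ = 0`, which are removed on the chart `x₀ ≠ 0` by subtracting the
exact form `d (y² / x)`. -/
def etaCocycle : Cocycle1 res₁ res₂ :=
  ⟨((x * y) • omega, (x * y) • (-omega), -(res₁ y ^ 2 * xinv)), etaCocycle_mem⟩

/-- The class `[ω_t]`. -/
def omegaClass : HesseH1 := cohomologyClass res₁ res₂ omegaCocycle

/-- The class `[η_t]`. -/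
def etaClass : HesseH1 := cohomologyClass res₁ res₂ etaCocycle

/-- The 1-form `dt / (1 - t³)` on `S = 𝔸¹ - μ₃`. -/
def dtOverDisc : Ω[Base⁄ℂ] := invDisc • KaehlerDifferential.D ℂ Base t

end HesseFamily

end

/-!
The proof reduces the theorem to bookkeeping with monomials and a few explicit polynomial identities.

*The basis.* The module of relative forms on a chart is free on `ω`. The functions on the overlap
map to the free module with basis `1, Y, Y²` over the Laurent polynomials `A[T, T⁻¹]`, where
`x ↦ T`, `y ↦ Y`. The functions from the chart `z₀ ≠ 0` are spanned by the `xⁱyʲ` with `i ≥ 0`, those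
from the chart `x₀ ≠ 0` by the `xⁱyʲ` with `i ≤ -j`, where `j ≤ 2`. So the only monomial missed by
both is `y² / x`, and the only one hit by both is `1` (`exists_overlap_eq`, `eq_const_of_res_eq`).
In other words `H⁰(U, 𝒪) = A` and `H¹(U, 𝒪) = A · [y² / x]`. The Hodge filtration then gives the
basis: subtracting a multiple of `η` and a coboundary makes the overlap component of a cocycle
vanish, and what is left is a global regular form, a constant multiple of `ω` (`exists_basis`).

*The connection is well defined.* The graph of the connecting homomorphism is stable under sums and
satisfies the Leibniz rule (`IsGaussManin.add`, `IsGaussManin.smul`). It is single-valued because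
`Ω_S` is generated by `dt` and `dt ∧ -` is injective on relative forms; the latter is seen by
evaluating 2-forms on a lift of `∂/∂t` and on the vertical vector field dual to `ω`
(`IsGaussManin.eq_zero`, `toRelative_eq_zero_of_baseWedge`). These derivations are constructed as
homomorphisms to dual numbers.

*The matrix.* The form `absOmega` lifts `ω` to an absolute form `ω̃` with
`dω̃ = (1 - t³)⁻¹ (t² - xy) dt ∧ ω̃` on each chart, and the two lifts (up to the sign in `res₂_omega`)
differ on the overlap by `(1 - t³)⁻¹ (y² / x) dt`. Hence the cochain `(ω̃, -ω̃, 0)` computes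
`∇[ω]` on the nose. For `η` the lift is `xy ω̃ + (1 - t³)⁻¹ (txy - y³) dt`. Its second summand
accounts for the exact form by which `d(xy ω̃)` differs from the expected one.
-/

noncomputable section

namespace CechDeRham

/-! ### Exterior derivative and pullback -/

section Forms

variable {R B C : Type*} [CommRing R] [CommRing B] [CommRing C] [Algebra R B] [Algebra R C]

theorem wedge_zero_left (β : Ω[B⁄R]) : wedge 0 β = 0 := by
  rw [← zero_smul B (0 : Ω[B⁄R]), wedge_smul_left, zero_smul]

theorem wedge_zero_right (α : Ω[B⁄R]) : wedge α 0 = 0 := by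
  rw [wedge_swap, wedge_zero_left, neg_zero]

theorem wedge_neg_right (α β : Ω[B⁄R]) : wedge α (-β) = -wedge α β := by
  refine eq_neg_of_add_eq_zero_left ?_
  rw [← wedge_add_right, neg_add_cancel, wedge_zero_right]

theorem extDeriv_D (b : B) : extDeriv R B (KaehlerDifferential.D R B b) = 0 := by
  rw [← one_smul B (KaehlerDifferential.D R B b), extDeriv_smul_D, Derivation.map_one_eq_zero,
    wedge_zero_left]

theorem extDeriv_leibniz (b : B) (α : Ω[B⁄R]) :
    extDeriv R B (b • α) = wedge (KaehlerDifferential.D R B b) α + b • extDeriv R B α := by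
  have h : α ∈ Submodule.span B (Set.range (KaehlerDifferential.D R B)) := by
    rw [KaehlerDifferential.span_range_derivation]; trivial
  refine Submodule.closure_induction (p := fun α _ => extDeriv R B (b • α) =
    wedge (KaehlerDifferential.D R B b) α + b • extDeriv R B α) ?_ ?_ ?_ h
  · simp only [smul_zero, map_zero, wedge_zero_right, add_zero]
  · intro α β _ _ hα hβ
    rw [smul_add, map_add, hα, hβ, map_add, wedge_add_right, smul_add]
    abel
  · rintro a _ ⟨c, rfl⟩
    rw [smul_smul, extDeriv_smul_D, extDeriv_smul_D, Derivation.leibniz, wedge_add_left,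
      wedge_smul_left, wedge_smul_left, wedge_smul_right, add_comm]

/-- The value `α(∂₁) β(∂₂) - α(∂₂) β(∂₁)` of a 2-form on a pair of derivations. -/
def evalTwoForm (D₁ D₂ : Derivation R B B) : TwoForms R B →ₗ[B] B :=
  exteriorPower.alternatingMapLinearEquiv
    ((Matrix.detRowAlternating (n := Fin 2) (R := B)).compLinearMap
      (LinearMap.pi ![D₁.liftKaehlerDifferential, D₂.liftKaehlerDifferential]))

theorem evalTwoForm_wedge (D₁ D₂ : Derivation R B B) (α β : Ω[B⁄R]) :
    evalTwoForm D₁ D₂ (wedge α β) =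
      D₁.liftKaehlerDifferential α * D₂.liftKaehlerDifferential β -
        D₂.liftKaehlerDifferential α * D₁.liftKaehlerDifferential β := by
  rw [evalTwoForm, wedge, exteriorPower.alternatingMapLinearEquiv_apply_ιMulti]
  simp only [AlternatingMap.compLinearMap_apply]
  exact Matrix.det_fin_two _

end Forms

section Complex

variable {R B₁ B₂ C : Type*} [CommRing R] [CommRing B₁] [CommRing B₂] [CommRing C]
  [Algebra R B₁] [Algebra R B₂] [Algebra R C]

theorem d1_d0 (ρ₁ : B₁ →ₐ[R] C) (ρ₂ : B₂ →ₐ[R] C) (b : B₁ × B₂) :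
    d1 ρ₁ ρ₂ (d0 ρ₁ ρ₂ b) = 0 := by
  obtain ⟨b₁, b₂⟩ := b
  rw [d0_apply, d1_apply, extDeriv_D, extDeriv_D, pullback_D, pullback_D, map_sub, sub_self]
  rfl

theorem cohomologyClass_eq_iff (ρ₁ : B₁ →ₐ[R] C) (ρ₂ : B₂ →ₐ[R] C) (z z' : Cocycle1 ρ₁ ρ₂) :
    cohomologyClass ρ₁ ρ₂ z = cohomologyClass ρ₁ ρ₂ z' ↔
      ∃ b, d0 ρ₁ ρ₂ b = (z : Cochain1 R B₁ B₂ C) - z' := by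
  rw [cohomologyClass, Submodule.mkQ_apply, Submodule.mkQ_apply, Submodule.Quotient.eq,
    Submodule.submoduleOf, Submodule.mem_comap]
  rfl

end Complex

/-! ### Formal properties of the Gauss–Manin graph -/

section GaussManin

variable {k A B₁ B₂ C : Type*} [CommRing k] [CommRing A] [CommRing B₁] [CommRing B₂] [CommRing C]
  [Algebra k A] [Algebra k B₁] [Algebra k B₂] [Algebra k C]
  [Algebra A B₁] [Algebra A B₂] [Algebra A C]
  [IsScalarTower k A B₁] [IsScalarTower k A B₂] [IsScalarTower k A C]

theorem map_base_D {B : Type*} [CommRing B] [Algebra k B] [Algebra A B] [IsScalarTower k A B]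
    (a : A) : KaehlerDifferential.map k k A B (KaehlerDifferential.D k A a) =
      KaehlerDifferential.D k B (algebraMap A B a) :=
  KaehlerDifferential.map_D k k A B a

theorem map_base_smul {B : Type*} [CommRing B] [Algebra k B] [Algebra A B] [IsScalarTower k A B]
    (a : A) (θ : Ω[A⁄k]) : KaehlerDifferential.map k k A B (a • θ) =
      algebraMap A B a • KaehlerDifferential.map k k A B θ := by
  rw [map_smul, algebraMap_smul]

section ToRelative

variable {k A B₁ B₂ C : Type*} [CommRing k] [CommRing A] [CommRing B₁] [CommRing B₂] [CommRing C]
  [Algebra k A] [Algebra k B₁] [Algebra k B₂] [Algebra A B₁] [Algebra A B₂]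
  [IsScalarTower k A B₁] [IsScalarTower k A B₂]

/-- Multiplication of an absolute cochain by a function on the base. -/
def baseSMul [Algebra A C] (a : A) (w : Cochain1 k B₁ B₂ C) : Cochain1 k B₁ B₂ C :=
  (algebraMap A B₁ a • w.1, algebraMap A B₂ a • w.2.1, algebraMap A C a * w.2.2)

theorem toRelative_add (w w' : Cochain1 k B₁ B₂ C) :
    toRelative k A B₁ B₂ C (w + w') = toRelative k A B₁ B₂ C w + toRelative k A B₁ B₂ C w' := by
  simp only [toRelative, Prod.fst_add, Prod.snd_add, map_add, Prod.mk_add_mk]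

theorem toRelative_sum {n : ℕ} (w : Fin n → Cochain1 k B₁ B₂ C) :
    toRelative k A B₁ B₂ C (∑ i, w i) = ∑ i, toRelative k A B₁ B₂ C (w i) :=
  map_sum (AddMonoidHom.mk' (toRelative k A B₁ B₂ C) toRelative_add) _ _

theorem toRelative_baseSMul [Algebra A C] (a : A) (w : Cochain1 k B₁ B₂ C) :
    toRelative k A B₁ B₂ C (baseSMul a w) = a • toRelative k A B₁ B₂ C w := by
  refine Prod.ext ?_ (Prod.ext ?_ ?_)
  · exact (LinearMap.map_smul _ _ _).trans (algebraMap_smul _ _ _)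
  · exact (LinearMap.map_smul _ _ _).trans (algebraMap_smul _ _ _)
  · exact (Algebra.smul_def _ _).symm

end ToRelative

theorem baseWedge_add_right (θ : Ω[A⁄k]) (w w' : Cochain1 k B₁ B₂ C) :
    baseWedge θ (w + w') = baseWedge θ w + baseWedge θ w' :=
  Prod.ext (wedge_add_right _ _ _) (Prod.ext (wedge_add_right _ _ _)
    ((congrArg Neg.neg (add_smul _ _ _)).trans (neg_add _ _)))

theorem baseWedge_sum_right {n : ℕ} (θ : Ω[A⁄k]) (w : Fin n → Cochain1 k B₁ B₂ C) :
    baseWedge θ (∑ i, w i) = ∑ i, baseWedge θ (w i) := by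
  induction n with
  | zero =>
    rw [Fin.sum_univ_zero, Fin.sum_univ_zero]
    refine Prod.ext (wedge_zero_right _) (Prod.ext (wedge_zero_right _) ?_)
    exact (congrArg Neg.neg (zero_smul C _)).trans neg_zero
  | succ n ih => rw [Fin.sum_univ_succ, Fin.sum_univ_succ, baseWedge_add_right, ih]

theorem baseWedge_smul_left (a : A) (θ : Ω[A⁄k]) (w : Cochain1 k B₁ B₂ C) :
    baseWedge (a • θ) w = baseWedge θ (baseSMul a w) := by
  simp only [baseWedge, baseSMul, map_base_smul, wedge_smul_left, wedge_smul_right, smul_smul,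
    mul_comm]

/-- The Leibniz rule for the differential of the absolute complex. -/
theorem d1_baseSMul (ρ₁ : B₁ →ₐ[A] C) (ρ₂ : B₂ →ₐ[A] C) (a : A) (w : Cochain1 k B₁ B₂ C) :
    d1 (ρ₁.restrictScalars k) (ρ₂.restrictScalars k) (baseSMul a w) =
      baseWedge (KaehlerDifferential.D k A a) w +
        (algebraMap A B₁ a • (d1 (ρ₁.restrictScalars k) (ρ₂.restrictScalars k) w).1,
          algebraMap A B₂ a • (d1 (ρ₁.restrictScalars k) (ρ₂.restrictScalars k) w).2.1,
          algebraMap A C a • (d1 (ρ₁.restrictScalars k) (ρ₂.restrictScalars k) w).2.2) := by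
  obtain ⟨α₁, α₂, f⟩ := w
  simp only [baseSMul, d1_apply, baseWedge, extDeriv_leibniz, pullback_smul, map_base_D,
    Derivation.leibniz, AlgHom.coe_restrictScalars', AlgHom.commutes, Prod.mk_add_mk]
  congr 2
  module

theorem smul_baseWedge (a : A) (θ : Ω[A⁄k]) (w : Cochain1 k B₁ B₂ C) :
    (algebraMap A B₁ a • (baseWedge θ w).1, algebraMap A B₂ a • (baseWedge θ w).2.1,
      algebraMap A C a • (baseWedge θ w).2.2) = baseWedge (a • θ) w := by
  refine Prod.ext ?_ (Prod.ext ?_ ?_)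
  · simp only [baseWedge, map_base_smul, wedge_smul_left]
  · simp only [baseWedge, map_base_smul, wedge_smul_left]
  · simp only [baseWedge, map_base_smul, smul_neg]
    rw [smul_comm]

variable {ρ₁ : B₁ →ₐ[A] C} {ρ₂ : B₂ →ₐ[A] C}

theorem IsGaussManin.add {c c' : H1dR ρ₁ ρ₂} {s s' : Ω[A⁄k] ⊗[A] H1dR ρ₁ ρ₂}
    (h : IsGaussManin k ρ₁ ρ₂ c s) (h' : IsGaussManin k ρ₁ ρ₂ c' s') :
    IsGaussManin k ρ₁ ρ₂ (c + c') (s + s') := by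
  obtain ⟨z, zt, n, θ, w, wt, hz, hzt, hw, hd, hs⟩ := h
  obtain ⟨z', zt', n', θ', w', wt', hz', hzt', hw', hd', hs'⟩ := h'
  refine ⟨z + z', zt + zt', n + n', Fin.append θ θ', Fin.append w w', Fin.append wt wt',
    by rw [map_add, hz, hz'], by rw [toRelative_add, hzt, hzt']; rfl, ?_, ?_, ?_⟩
  · intro i
    induction i using Fin.addCases with
    | left i => rw [Fin.append_left, Fin.append_left, hw]
    | right i => rw [Fin.append_right, Fin.append_right, hw']
  · simp only [map_add, hd, hd', Fin.sum_univ_add, Fin.append_left, Fin.append_right]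
  · simp only [hs, hs', Fin.sum_univ_add, Fin.append_left, Fin.append_right]

theorem IsGaussManin.smul (a : A) {c : H1dR ρ₁ ρ₂} {s : Ω[A⁄k] ⊗[A] H1dR ρ₁ ρ₂}
    (h : IsGaussManin k ρ₁ ρ₂ c s) :
    IsGaussManin k ρ₁ ρ₂ (a • c) (KaehlerDifferential.D k A a ⊗ₜ[A] c + a • s) := by
  obtain ⟨z, zt, n, θ, w, wt, hz, hzt, hw, hd, hs⟩ := h
  -- The Leibniz rule of the complex contributes the extra summand `da ∧ zt`, put at index `0`.
  refine ⟨a • z, baseSMul a zt, n + 1, Fin.cons (KaehlerDifferential.D k A a) (fun i => a • θ i),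
    Fin.cons z w, Fin.cons zt wt, by rw [map_smul, hz], by rw [toRelative_baseSMul, hzt]; rfl,
    ?_, ?_, ?_⟩
  · intro i
    cases i using Fin.cases with
    | zero => exact hzt
    | succ i => exact hw i
  · rw [Fin.sum_univ_succ, d1_baseSMul, hd]
    simp only [Fin.cons_zero, Fin.cons_succ, ← smul_baseWedge]
    rw [add_right_inj]
    simp only [Prod.ext_iff, Prod.fst_sum, Prod.snd_sum, Finset.smul_sum, and_self]
  · rw [Fin.sum_univ_succ, hs, Finset.smul_sum]
    simp only [Fin.cons_zero, Fin.cons_succ, hz, TensorProduct.smul_tmul']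

theorem IsGaussManin.sub {c c' : H1dR ρ₁ ρ₂} {s s' : Ω[A⁄k] ⊗[A] H1dR ρ₁ ρ₂}
    (h : IsGaussManin k ρ₁ ρ₂ c s) (h' : IsGaussManin k ρ₁ ρ₂ c' s') :
    IsGaussManin k ρ₁ ρ₂ (c - c') (s - s') := by
  have h1 := h.add (h'.smul (-1))
  rwa [map_neg, Derivation.map_one_eq_zero, neg_zero, TensorProduct.zero_tmul, zero_add,
    neg_one_smul, neg_one_smul, ← sub_eq_add_neg, ← sub_eq_add_neg] at h1

/-- The kernel of `Ω_{B/k} → Ω_{B/A}` is generated by the forms from the base. -/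
theorem exists_eq_smul_of_map_eq_zero {B : Type*} [CommRing B] [Algebra k B] [Algebra A B]
    [IsScalarTower k A B] (τ : A) (hτ : ∀ θ : Ω[A⁄k], ∃ a : A, θ = a • KaehlerDifferential.D k A τ)
    (β : Ω[B⁄k]) (hβ : KaehlerDifferential.map k A B B β = 0) :
    ∃ b : B, β = b • KaehlerDifferential.D k B (algebraMap A B τ) := by
  obtain ⟨u, rfl⟩ := (KaehlerDifferential.exact_mapBaseChange_map k A B β).mp hβ
  induction u using TensorProduct.induction_on with
  | zero => exact ⟨0, by rw [map_zero, zero_smul]⟩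
  | tmul b θ =>
    obtain ⟨a, rfl⟩ := hτ θ
    exact ⟨b * algebraMap A B a, by
      rw [KaehlerDifferential.mapBaseChange_tmul, map_base_smul, map_base_D, smul_smul]⟩
  | add u v hu hv =>
    obtain ⟨b, hb⟩ := hu ((KaehlerDifferential.exact_mapBaseChange_map k A B _).mpr ⟨u, rfl⟩)
    obtain ⟨b', hb'⟩ := hv ((KaehlerDifferential.exact_mapBaseChange_map k A B _).mpr ⟨v, rfl⟩)
    exact ⟨b + b', by rw [map_add, hb, hb', add_smul]⟩

/-- The connecting homomorphism is single-valued when `Ω_{A/k}` is generated by one exact form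
`dτ` and `dτ ∧ -` is injective on relative cochains of degree 1. -/
theorem IsGaussManin.eq_zero (τ : A)
    (hτ : ∀ θ : Ω[A⁄k], ∃ a : A, θ = a • KaehlerDifferential.D k A τ)
    (hinj : ∀ w : Cochain1 k B₁ B₂ C, baseWedge (KaehlerDifferential.D k A τ) w = 0 →
      toRelative k A B₁ B₂ C w = 0)
    {s : Ω[A⁄k] ⊗[A] H1dR ρ₁ ρ₂} (h : IsGaussManin k ρ₁ ρ₂ 0 s) : s = 0 := by
  obtain ⟨z, zt, n, θ, w, wt, hz, hzt, hw, hd, rfl⟩ := h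
  choose a ha using hτ
  obtain ⟨⟨b₁, b₂⟩, hb⟩ := (cohomologyClass_eq_iff ρ₁ ρ₂ z 0).mp (by rw [hz, map_zero])
  rw [ZeroMemClass.coe_zero, sub_zero, ← hzt] at hb
  obtain ⟨α₁, α₂, f⟩ := zt
  simp only [d0_apply, toRelative, Prod.mk.injEq] at hb
  obtain ⟨h1, h2, h3⟩ := hb
  -- The absolute cochain differs from the coboundary of `(b₁, b₂)` by multiples of `dτ`.
  obtain ⟨e₁, he₁⟩ := exists_eq_smul_of_map_eq_zero τ (fun θ => ⟨a θ, ha θ⟩)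
    (α₁ - KaehlerDifferential.D k B₁ b₁)
    (by rw [map_sub, ← h1, KaehlerDifferential.map_D]; exact sub_self _)
  obtain ⟨e₂, he₂⟩ := exists_eq_smul_of_map_eq_zero τ (fun θ => ⟨a θ, ha θ⟩)
    (α₂ - KaehlerDifferential.D k B₂ b₂)
    (by rw [map_sub, ← h2, KaehlerDifferential.map_D]; exact sub_self _)
  -- If `zt = d0 b + e dτ`, then `d1 zt = -dτ ∧ d0 e`, so that `dτ ∧ (∑ aᵢ wᵢ + d0 e) = 0` when
  -- `θᵢ = aᵢ dτ`. Cancelling `dτ` shows that `∑ aᵢ wᵢ` is a relative coboundary.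
  have hkey : baseWedge (KaehlerDifferential.D k A τ)
      (∑ i, baseSMul (a (θ i)) (wt i) +
        d0 (ρ₁.restrictScalars k) (ρ₂.restrictScalars k) (e₁, e₂)) = 0 := by
    have e : d1 (ρ₁.restrictScalars k) (ρ₂.restrictScalars k) (α₁, α₂, f) =
        -baseWedge (KaehlerDifferential.D k A τ)
          (d0 (ρ₁.restrictScalars k) (ρ₂.restrictScalars k) (e₁, e₂)) := by
      rw [sub_eq_iff_eq_add] at he₁ he₂
      rw [he₁, he₂, ← h3, d0_apply, d1_apply, baseWedge]
      simp only [map_add, map_sub, extDeriv_leibniz, extDeriv_D, pullback_smul, pullback_D,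
        map_base_D, AlgHom.coe_restrictScalars', AlgHom.commutes, smul_zero, add_zero,
        Prod.neg_mk, neg_neg]
      rw [wedge_swap (KaehlerDifferential.D k B₁ e₁), wedge_swap (KaehlerDifferential.D k B₂ e₂)]
      congr 2
      module
    rw [baseWedge_add_right, baseWedge_sum_right, ← neg_eq_zero, neg_add, ← e, hd,
      ← sub_eq_neg_add, sub_eq_zero]
    exact Finset.sum_congr rfl fun i _ => by rw [← baseWedge_smul_left, ← ha]
  have hrel := hinj _ hkey
  have hd0 : toRelative k A B₁ B₂ C (d0 (ρ₁.restrictScalars k) (ρ₂.restrictScalars k) (e₁, e₂)) =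
      d0 ρ₁ ρ₂ (e₁, e₂) := by
    simp only [toRelative, d0_apply, KaehlerDifferential.map_D]
    rfl
  rw [toRelative_add, toRelative_sum, hd0] at hrel
  simp only [toRelative_baseSMul, hw] at hrel
  have hcls : cohomologyClass ρ₁ ρ₂ (∑ i, a (θ i) • w i) = 0 := by
    rw [← map_zero (cohomologyClass ρ₁ ρ₂), cohomologyClass_eq_iff]
    refine ⟨-(e₁, e₂), ?_⟩
    rw [map_neg, add_eq_zero_iff_neg_eq.mp ((add_comm _ _).trans hrel), ZeroMemClass.coe_zero,
      sub_zero, AddSubmonoidClass.coe_finsetSum]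
    rfl
  calc ∑ i, θ i ⊗ₜ[A] cohomologyClass ρ₁ ρ₂ (w i)
      = ∑ i, KaehlerDifferential.D k A τ ⊗ₜ[A] (a (θ i) • cohomologyClass ρ₁ ρ₂ (w i)) :=
        Finset.sum_congr rfl fun i _ => by
          rw [← TensorProduct.smul_tmul, ← ha]
    _ = KaehlerDifferential.D k A τ ⊗ₜ[A] cohomologyClass ρ₁ ρ₂ (∑ i, a (θ i) • w i) := by
        simp only [map_sum, map_smul, TensorProduct.tmul_sum]
    _ = 0 := by rw [hcls, TensorProduct.tmul_zero]

end GaussManin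

end CechDeRham

end

noncomputable section

namespace HesseFamily

open CechDeRham

/-! ### Homomorphisms out of the coordinate rings -/

theorem exists_baseHom {K : Type*} [CommRing K] [Algebra ℂ K] (τ : K) (h : IsUnit (1 - τ ^ 3)) :
    ∃ g : Base →ₐ[ℂ] K, g t = τ := by
  have hu : IsUnit ((Polynomial.aeval τ : Polynomial ℂ →ₐ[ℂ] K).toRingHom
      (1 - Polynomial.X ^ 3)) := by
    simpa using h
  refine ⟨⟨IsLocalization.Away.lift (S := Base) (1 - Polynomial.X ^ 3 : Polynomial ℂ) hu, ?_⟩, ?_⟩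
  · intro r
    rw [IsScalarTower.algebraMap_apply ℂ (Polynomial ℂ) Base]
    refine (IsLocalization.Away.lift_eq _ hu _).trans ?_
    exact (Polynomial.aeval τ).commutes r
  · exact (IsLocalization.Away.lift_eq _ hu _).trans (Polynomial.aeval_X τ)

theorem baseHom_ext {K : Type*} [CommRing K] [Algebra ℂ K] {g g' : Base →ₐ[ℂ] K}
    (h : g t = g' t) : g = g' := by
  have e : (g : Base →+* K) = g' := by
    refine IsLocalization.ringHom_ext (Submonoid.powers (1 - Polynomial.X ^ 3 : Polynomial ℂ)) ?_
    refine Polynomial.ringHom_ext (fun r => ?_) h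
    simp only [RingHom.comp_apply]
    rw [← Polynomial.algebraMap_eq, ← IsScalarTower.algebraMap_apply ℂ (Polynomial ℂ) Base]
    exact (g.commutes r).trans (g'.commutes r).symm
  exact AlgHom.ext fun a => RingHom.congr_fun e a

theorem exists_chartHom {K : Type*} [CommRing K] (g : Base →+* K) (a b : K)
    (h : a ^ 3 + b ^ 3 + 1 = 3 * g t * a * b) :
    ∃ φ : Chart →+* K, (∀ r, φ (algebraMap Base Chart r) = g r) ∧ φ x = a ∧ φ y = b := by
  have hr : hessePoly.eval₂ (Polynomial.eval₂RingHom g a) b = 0 := by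
    simp only [hessePoly, Polynomial.eval₂_sub, Polynomial.eval₂_add, Polynomial.eval₂_mul,
      Polynomial.eval₂_pow, Polynomial.eval₂_C, Polynomial.eval₂_X, Polynomial.eval₂_one,
      Polynomial.eval₂_ofNat, Polynomial.coe_eval₂RingHom]
    exact sub_eq_zero.mpr h
  refine ⟨AdjoinRoot.lift (Polynomial.eval₂RingHom g a) b hr, fun r => ?_, ?_, ?_⟩
  · refine (AdjoinRoot.lift_of hr (x := Polynomial.C r)).trans ?_
    simp
  · refine (AdjoinRoot.lift_of hr (x := Polynomial.X)).trans ?_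
    simp
  · exact AdjoinRoot.lift_root hr

theorem chartHom_ext {K : Type*} [CommRing K] {φ φ' : Chart →+* K}
    (h : ∀ r, φ (algebraMap Base Chart r) = φ' (algebraMap Base Chart r))
    (hx : φ x = φ' x) (hy : φ y = φ' y) : φ = φ' :=
  AdjoinRoot.ringHom_ext (Polynomial.ringHom_ext h hx) hy

theorem exists_overlapHom {K : Type*} [CommRing K] (φ : Chart →+* K) (h : IsUnit (φ x)) :
    ∃ ψ : Overlap →+* K, ∀ c, ψ (res₁ c) = φ c :=
  ⟨IsLocalization.Away.lift x h, fun c => IsLocalization.Away.lift_eq x h c⟩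

theorem overlapHom_ext {K : Type*} [CommRing K] {ψ ψ' : Overlap →+* K}
    (h : ∀ c, ψ (res₁ c) = ψ' (res₁ c)) : ψ = ψ' :=
  IsLocalization.ringHom_ext (Submonoid.powers x) (RingHom.ext h)

/-! ### Derivations of the coordinate rings -/

/-- A derivation from a first-order deformation `b ↦ b + ε D(b)` of the identity. -/
theorem exists_derivation_of_dualNumber {R B : Type*} [CommRing R] [CommRing B] [Algebra R B]
    (φ : B →+* DualNumber B) (hfst : ∀ b, (φ b).fst = b)
    (hR : ∀ r, φ (algebraMap R B r) = TrivSqZeroExt.inl (algebraMap R B r)) :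
    ∃ D : Derivation R B B, ∀ b, D b = (φ b).snd := by
  refine ⟨Derivation.mk' ⟨⟨fun b => (φ b).snd, fun a b => ?_⟩, fun r b => ?_⟩ fun a b => ?_,
    fun b => rfl⟩
  · rw [map_add, TrivSqZeroExt.snd_add]
  · change (φ (r • b)).snd = r • (φ b).snd
    rw [Algebra.smul_def, map_mul, hR, TrivSqZeroExt.snd_mul]
    simp [Algebra.smul_def]
  · change (φ (a * b)).snd = _
    rw [map_mul, TrivSqZeroExt.snd_mul, hfst, hfst, op_smul_eq_smul]
    rfl

/-- Tangent vectors to the total space: a triple `(e, a, b)` annihilated by the differential of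
the equation is the value of a derivation on `(t, x, y)`. -/
theorem exists_derivation_chart (e a b : Chart)
    (h : (x ^ 2 - tc * y) * a + (y ^ 2 - tc * x) * b = x * y * e) :
    ∃ D : Derivation ℂ Chart Chart, D tc = e ∧ D x = a ∧ D y = b := by
  have hu : IsUnit (1 - (TrivSqZeroExt.inl tc + TrivSqZeroExt.inr e : DualNumber Chart) ^ 3) := by
    rw [TrivSqZeroExt.isUnit_iff_isUnit_fst]
    simp only [TrivSqZeroExt.fst_sub, TrivSqZeroExt.fst_one, TrivSqZeroExt.fst_pow,
      TrivSqZeroExt.fst_add, TrivSqZeroExt.fst_inl, TrivSqZeroExt.fst_inr, add_zero]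
    exact IsUnit.of_mul_eq_one _ tc_invDisc
  obtain ⟨g, hg⟩ := exists_baseHom _ hu
  have hgfst : ∀ r, (g r).fst = algebraMap Base Chart r := by
    intro r
    have := baseHom_ext (g := (TrivSqZeroExt.fstHom ℂ Chart Chart).comp g)
      (g' := IsScalarTower.toAlgHom ℂ Base Chart) (by
        simp only [AlgHom.comp_apply, hg]
        simp)
    exact AlgHom.congr_fun this r
  obtain ⟨φ, hφ, hx, hy⟩ := exists_chartHom (g : Base →+* DualNumber Chart)
    (TrivSqZeroExt.inl x + TrivSqZeroExt.inr a) (TrivSqZeroExt.inl y + TrivSqZeroExt.inr b) (by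
      rw [RingHom.coe_coe, hg]
      have e3 : (3 : DualNumber Chart) = TrivSqZeroExt.inl 3 := rfl
      rw [e3]
      refine TrivSqZeroExt.ext ?_ ?_
      · simpa using chart_relation
      · simp [TrivSqZeroExt.snd_pow, TrivSqZeroExt.snd_mul]
        linear_combination 3 * h)
  obtain ⟨D, hD⟩ := exists_derivation_of_dualNumber (R := ℂ) φ (fun c => by
      have := chartHom_ext
        (φ := (TrivSqZeroExt.fstHom ℂ Chart Chart : DualNumber Chart →+* Chart).comp φ)
        (φ' := RingHom.id Chart) (fun r => by simp [hφ, hgfst]) (by simp [hx]) (by simp [hy])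
      exact RingHom.congr_fun this c)
    (fun r => by
      rw [IsScalarTower.algebraMap_apply ℂ Base Chart, hφ]
      refine (g.commutes r).trans ?_
      rw [← IsScalarTower.algebraMap_apply ℂ Base Chart]
      rfl)
  refine ⟨D, ?_, ?_, ?_⟩
  · rw [hD, hφ, RingHom.coe_coe, hg]; simp
  · rw [hD, hx]; simp
  · rw [hD, hy]; simp

/-- Derivations extend to the localization. -/
theorem exists_derivation_overlap (D : Derivation ℂ Chart Chart) :
    ∃ D' : Derivation ℂ Overlap Overlap, ∀ c, D' (res₁ c) = res₁ (D c) := by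
  let φ : Chart →+* DualNumber Overlap :=
    { toFun := fun c => TrivSqZeroExt.inl (res₁ c) + TrivSqZeroExt.inr (res₁ (D c))
      map_one' := by simp
      map_zero' := by simp
      map_mul' := fun a b => by
        refine TrivSqZeroExt.ext ?_ ?_
        · simp
        · simp [mul_comm]
      map_add' := fun a b => by
        refine TrivSqZeroExt.ext ?_ ?_ <;> simp }
  have hφ : ∀ c, φ c = TrivSqZeroExt.inl (res₁ c) + TrivSqZeroExt.inr (res₁ (D c)) :=
    fun _ => rfl
  obtain ⟨ψ, hψ⟩ := exists_overlapHom φ (by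
    rw [TrivSqZeroExt.isUnit_iff_isUnit_fst, hφ]
    have hx : IsUnit (res₁ x) := IsUnit.of_mul_eq_one _ x_mul_xinv
    simpa using hx)
  obtain ⟨D', hD'⟩ := exists_derivation_of_dualNumber (R := ℂ) ψ (fun c => by
      have := overlapHom_ext
        (ψ := (TrivSqZeroExt.fstHom ℂ Overlap Overlap : DualNumber Overlap →+* Overlap).comp ψ)
        (ψ' := RingHom.id Overlap) (fun c => by simp [hψ, hφ])
      exact RingHom.congr_fun this c)
    (fun r => by
      have e : algebraMap ℂ Overlap r = res₁ (algebraMap ℂ Chart r) := by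
        rw [IsScalarTower.algebraMap_apply ℂ Base Chart, AlgHom.commutes,
          ← IsScalarTower.algebraMap_apply ℂ Base Overlap]
      rw [e, hψ, hφ, Derivation.map_algebraMap, map_zero, TrivSqZeroExt.inr_zero, add_zero])
  exact ⟨D', fun c => by rw [hD', hψ, hφ]; simp⟩

/-- `Ω_{S/ℂ}` is generated by `dt`. -/
theorem exists_eq_smul_D_t (θ : Ω[Base⁄ℂ]) :
    ∃ a : Base, θ = a • KaehlerDifferential.D ℂ Base t := by
  have h : θ ∈ (⊤ : Submodule Base Ω[Base⁄ℂ]) := trivial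
  rw [← KaehlerDifferential.span_range_map_derivation_of_isLocalization ℂ (Polynomial ℂ) Base
    (Submonoid.powers (1 - Polynomial.X ^ 3 : Polynomial ℂ))] at h
  have hle : Submodule.span Base (Set.range (KaehlerDifferential.map ℂ ℂ (Polynomial ℂ) Base ∘
      KaehlerDifferential.D ℂ (Polynomial ℂ))) ≤
        Submodule.span Base {KaehlerDifferential.D ℂ Base t} := by
    rw [Submodule.span_le]
    rintro _ ⟨p, rfl⟩
    rw [Function.comp_apply, KaehlerDifferential.map_D]
    have e : algebraMap (Polynomial ℂ) Base p = Polynomial.aeval t p := by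
      induction p using Polynomial.induction_on' with
      | add p q hp hq => rw [map_add, map_add, hp, hq]
      | monomial n a =>
        rw [← Polynomial.C_mul_X_pow_eq_monomial, map_mul, map_pow, map_mul, map_pow,
          Polynomial.aeval_X, Polynomial.aeval_C,
          IsScalarTower.algebraMap_apply ℂ (Polynomial ℂ) Base]
        rfl
    rw [e, Derivation.map_aeval]
    exact Submodule.smul_mem _ _ (Submodule.mem_span_singleton_self _)
  obtain ⟨a, ha⟩ := Submodule.mem_span_singleton.mp (hle h)
  exact ⟨a, ha.symm⟩

/-- A derivation over `ℂ` that kills `t` is linear over the base. -/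
theorem exists_relative_derivation {B : Type*} [CommRing B] [Algebra ℂ B] [Algebra Base B]
    [IsScalarTower ℂ Base B] (D : Derivation ℂ B B) (h : D (algebraMap Base B t) = 0) :
    ∃ D' : Derivation Base B B, ∀ b, D' b = D b := by
  have h0 : ∀ r : Base, D (algebraMap Base B r) = 0 := by
    intro r
    obtain ⟨a, ha⟩ := exists_eq_smul_D_t (KaehlerDifferential.D ℂ Base r)
    have := congrArg (fun θ => D.liftKaehlerDifferential (KaehlerDifferential.map ℂ ℂ Base B θ)) ha
    rwa [map_base_smul, map_base_D, map_base_D, map_smul,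
      Derivation.liftKaehlerDifferential_comp_D, Derivation.liftKaehlerDifferential_comp_D, h,
      smul_zero] at this
  refine ⟨Derivation.mk' ⟨⟨D, D.map_add⟩, fun r b => ?_⟩ fun a b => D.leibniz a b, fun _ => rfl⟩
  change D (r • b) = r • D b
  rw [Algebra.smul_def, D.leibniz, h0, smul_zero, add_zero, algebraMap_smul]

/-! ### Coefficients of Laurent polynomials -/

section Laurent

variable {R : Type*} [CommRing R]

theorem coeff_toLaurent_natCast (p : Polynomial R) (i : ℕ) :
    (Polynomial.toLaurent p).coeff (i : ℤ) = p.coeff i := by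
  rw [LaurentPolynomial.coeff_toLaurent]
  exact Finsupp.mapDomain_apply Nat.cast_injective _ _

theorem coeff_toLaurent_of_neg (p : Polynomial R) {i : ℤ} (hi : i < 0) :
    (Polynomial.toLaurent p).coeff i = 0 := by
  rw [LaurentPolynomial.coeff_toLaurent]
  refine Finsupp.mapDomain_of_notMem_range _ _ ?_
  rintro ⟨n, hn⟩
  have : ((n : ℕ) : ℤ) = i := hn
  lia

theorem coeff_mul_T (p : LaurentPolynomial R) (n i : ℤ) :
    (p * LaurentPolynomial.T n).coeff i = p.coeff (i - n) := by
  rw [LaurentPolynomial.T, AddMonoidAlgebra.coeff_mul_single_apply, mul_one, sub_eq_add_neg]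

end Laurent

/-! ### Functions on the overlap -/

/-- The ring of a chart is spanned by `1, y, y²` over the polynomials in `x`, since the equation of
the family is monic of degree 3 in `y`. -/
theorem exists_chart_eq (b : Chart) : ∃ p₀ p₁ p₂ : Polynomial Base,
    b = Polynomial.aeval x p₀ + Polynomial.aeval x p₁ * y + Polynomial.aeval x p₂ * y ^ 2 := by
  let π : Polynomial (Polynomial Base) →+* Chart := AdjoinRoot.mk hessePoly
  have hC : ∀ p, π (Polynomial.C p) = Polynomial.aeval x p := by
    have h : π.comp Polynomial.C = (Polynomial.aeval (R := Base) x : Polynomial Base →+* Chart) :=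
      Polynomial.ringHom_ext (fun a => by simp; rfl) (by simp; rfl)
    exact fun p => RingHom.congr_fun h p
  have hX : π Polynomial.X = y := rfl
  obtain ⟨p, rfl⟩ : ∃ p, π p = b := AdjoinRoot.mk_surjective b
  induction p using Polynomial.induction_on' with
  | add p q hp hq =>
    obtain ⟨p₀, p₁, p₂, hp⟩ := hp
    obtain ⟨q₀, q₁, q₂, hq⟩ := hq
    refine ⟨p₀ + q₀, p₁ + q₁, p₂ + q₂, ?_⟩
    simp only [map_add]
    rw [hp, hq]
    ring
  | monomial n a =>
    induction n with
    | zero =>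
      refine ⟨a, 0, 0, ?_⟩
      rw [Polynomial.monomial_zero_left, hC, map_zero, zero_mul, zero_mul, add_zero, add_zero]
    | succ n ih =>
      obtain ⟨p₀, p₁, p₂, h⟩ := ih
      refine ⟨-(Polynomial.X ^ 3 + 1) * p₂,
        p₀ + 3 * Polynomial.C t * Polynomial.X * p₂, p₁, ?_⟩
      rw [← Polynomial.monomial_mul_X, map_mul, hX, h]
      simp only [map_add, map_mul, map_neg, map_pow, map_one, map_ofNat, Polynomial.aeval_X,
        Polynomial.aeval_C]
      linear_combination Polynomial.aeval x p₂ * chart_relation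

/-- `Y³ - 3tTY + T³ + 1`, the equation of the family over the Laurent polynomials in `T`. -/
def laurentHesse : Polynomial (LaurentPolynomial Base) :=
  Polynomial.X ^ 3 + (Polynomial.C (-(3 * LaurentPolynomial.C t * LaurentPolynomial.T 1)) *
    Polynomial.X + Polynomial.C (LaurentPolynomial.T 1 ^ 3 + 1))

instance : Nontrivial Base :=
  (IsLocalization.injective Base (M := Submonoid.powers (1 - Polynomial.X ^ 3 : Polynomial ℂ))
    (powers_le_nonZeroDivisors_of_noZeroDivisors fun h => by
      have := congrArg (Polynomial.eval 0) h
      simp at this)).nontrivial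

theorem laurentHesse_degree_aux :
    (Polynomial.C (-(3 * LaurentPolynomial.C t * LaurentPolynomial.T 1)) *
      Polynomial.X + Polynomial.C (LaurentPolynomial.T 1 ^ 3 + 1) :
        Polynomial (LaurentPolynomial Base)).degree < (3 : ℕ) :=
  Polynomial.degree_linear_le.trans_lt (by norm_num)

theorem laurentHesse_monic : laurentHesse.Monic :=
  Polynomial.monic_X_pow_add laurentHesse_degree_aux

theorem laurentHesse_natDegree : laurentHesse.natDegree = 3 := by
  have h := laurentHesse_degree_aux
  refine Polynomial.natDegree_eq_of_degree_eq_some ?_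
  rw [laurentHesse, Polynomial.degree_add_eq_left_of_degree_lt] <;> rw [Polynomial.degree_X_pow]
  exact h

theorem laurent_linearIndependent {p q r : LaurentPolynomial Base}
    (h : AdjoinRoot.of laurentHesse p + AdjoinRoot.of laurentHesse q * AdjoinRoot.root laurentHesse
      + AdjoinRoot.of laurentHesse r * AdjoinRoot.root laurentHesse ^ 2 = 0) :
    p = 0 ∧ q = 0 ∧ r = 0 := by
  have h0 : Polynomial.C r * Polynomial.X ^ 2 + Polynomial.C q * Polynomial.X + Polynomial.C p =
      0 := by
    by_contra hne
    refine AdjoinRoot.mk_ne_zero_of_natDegree_lt laurentHesse_monic hne ?_ ?_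
    · rw [laurentHesse_natDegree]
      exact Polynomial.natDegree_quadratic_le.trans_lt (by norm_num)
    · rw [← h]
      simp only [map_add, map_mul, map_pow, AdjoinRoot.mk_C, AdjoinRoot.mk_X]
      ring
  refine ⟨?_, ?_, ?_⟩
  · simpa using congrArg (fun f => Polynomial.coeff f 0) h0
  · simpa using congrArg (fun f => Polynomial.coeff f 1) h0
  · simpa [Polynomial.coeff_C] using congrArg (fun f => Polynomial.coeff f 2) h0

/-- The overlap maps to the free module with basis `1, Y, Y²` over the Laurent polynomials. -/
theorem exists_overlap_expansion : ∃ ψ : Overlap →+* AdjoinRoot laurentHesse,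
    (∀ r, ψ (algebraMap Base Overlap r) = AdjoinRoot.of laurentHesse (LaurentPolynomial.C r)) ∧
    ψ (res₁ x) = AdjoinRoot.of laurentHesse (LaurentPolynomial.T 1) ∧
    ψ xinv = AdjoinRoot.of laurentHesse (LaurentPolynomial.T (-1)) ∧
    ψ (res₁ y) = AdjoinRoot.root laurentHesse := by
  have hT : (LaurentPolynomial.T 1 * LaurentPolynomial.T (-1) : LaurentPolynomial Base) = 1 := by
    rw [← LaurentPolynomial.T_add, add_neg_cancel, LaurentPolynomial.T_zero]
  have hT' := congrArg (AdjoinRoot.of laurentHesse) hT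
  rw [map_mul, map_one] at hT'
  have hr : AdjoinRoot.mk laurentHesse (Polynomial.X ^ 3 +
      (Polynomial.C (-(3 * LaurentPolynomial.C t * LaurentPolynomial.T 1)) *
        Polynomial.X + Polynomial.C (LaurentPolynomial.T 1 ^ 3 + 1))) = 0 := AdjoinRoot.mk_self
  simp only [map_add, map_mul, map_pow, AdjoinRoot.mk_C, AdjoinRoot.mk_X, map_neg, map_one,
    map_ofNat] at hr
  obtain ⟨φ, hφ, hx, hy⟩ := exists_chartHom
    ((AdjoinRoot.of laurentHesse).comp (LaurentPolynomial.C : Base →+* LaurentPolynomial Base))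
    (AdjoinRoot.of laurentHesse (LaurentPolynomial.T 1)) (AdjoinRoot.root laurentHesse) (by
      rw [RingHom.comp_apply]
      exact sub_eq_zero.mp (Eq.trans (by ring) hr))
  obtain ⟨ψ, hψ⟩ := exists_overlapHom φ (by rw [hx]; exact IsUnit.of_mul_eq_one _ hT')
  refine ⟨ψ, fun r => ?_, by rw [hψ, hx], ?_, by rw [hψ, hy]⟩
  · rw [← AlgHom.commutes res₁, hψ, hφ, RingHom.comp_apply]
  · have h1 : res₁ x * xinv = 1 := x_mul_xinv
    have h2 := congrArg ψ h1
    rw [map_mul, map_one, hψ, hx] at h2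
    linear_combination AdjoinRoot.of laurentHesse (LaurentPolynomial.T (-1)) * h2 - ψ xinv * hT'

/-- Comparison of the monomials `xⁱyʲ`, `j ≤ 2`: those with `i ≥ 0` span the functions on the chart
`z₀ ≠ 0`, those with `i ≤ -j` span the functions on the chart `x₀ ≠ 0`. Only `1` is in both spans,
and `y² / x` is in neither. -/
theorem eq_const_of_res_eq {c : Base} {b₁ b₂ : Chart}
    (h : c • (res₁ y ^ 2 * xinv) + res₂ b₂ = res₁ b₁) :
    c = 0 ∧ ∃ a : Base, b₁ = algebraMap Base Chart a ∧ b₂ = algebraMap Base Chart a := by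
  obtain ⟨p₀, p₁, p₂, rfl⟩ := exists_chart_eq b₁
  obtain ⟨q₀, q₁, q₂, rfl⟩ := exists_chart_eq b₂
  obtain ⟨ψ, hC, hx, hxi, hy⟩ := exists_overlap_expansion
  have e₁ : ∀ p : Polynomial Base, ψ (res₁ (Polynomial.aeval x p)) =
      AdjoinRoot.of laurentHesse (Polynomial.toLaurent p) := by
    intro p
    induction p using Polynomial.induction_on' with
    | add p q hp hq => simp only [map_add, hp, hq]
    | monomial n a =>
      rw [← Polynomial.C_mul_X_pow_eq_monomial]
      simp only [map_mul, map_pow, Polynomial.aeval_C, Polynomial.aeval_X, AlgHom.commutes, hC, hx,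
        Polynomial.toLaurent_C, Polynomial.toLaurent_X]
  have e₂ : ∀ p : Polynomial Base, ψ (res₂ (Polynomial.aeval x p)) =
      AdjoinRoot.of laurentHesse (LaurentPolynomial.invert (Polynomial.toLaurent p)) := by
    intro p
    induction p using Polynomial.induction_on' with
    | add p q hp hq => simp only [map_add, hp, hq]
    | monomial n a =>
      rw [← Polynomial.C_mul_X_pow_eq_monomial]
      simp only [map_mul, map_pow, Polynomial.aeval_C, Polynomial.aeval_X, AlgHom.commutes, hC, hxi,
        res₂_x, Polynomial.toLaurent_C, Polynomial.toLaurent_X, LaurentPolynomial.invert_C,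
        LaurentPolynomial.invert_T]
  have h' := congrArg ψ h
  simp only [Algebra.smul_def, map_add, map_mul, map_pow, e₁, e₂, hC, hxi, hy, res₂_y] at h'
  obtain ⟨h0, h1, h2⟩ := laurent_linearIndependent
    (p := LaurentPolynomial.invert (Polynomial.toLaurent q₀) - Polynomial.toLaurent p₀)
    (q := LaurentPolynomial.invert (Polynomial.toLaurent q₁) * LaurentPolynomial.T (-1) -
      Polynomial.toLaurent p₁)
    (r := LaurentPolynomial.C c * LaurentPolynomial.T (-1) +
      LaurentPolynomial.invert (Polynomial.toLaurent q₂) * LaurentPolynomial.T (-2) -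
      Polynomial.toLaurent p₂) (by
    have hT : (LaurentPolynomial.T (-2) : LaurentPolynomial Base) =
        LaurentPolynomial.T (-1) ^ 2 := by
      rw [LaurentPolynomial.T_pow]; rfl
    rw [hT]
    simp only [map_sub, map_add, map_mul, map_pow]
    linear_combination h')
  have c0 := fun i : ℤ => congrArg (fun f : LaurentPolynomial Base => f.coeff i) (sub_eq_zero.mp h0)
  have c1 := fun i : ℤ => congrArg (fun f : LaurentPolynomial Base => f.coeff i) (sub_eq_zero.mp h1)
  have c2 := fun i : ℤ => congrArg (fun f : LaurentPolynomial Base => f.coeff i) (sub_eq_zero.mp h2)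
  simp only [AddMonoidAlgebra.coeff_add, Finsupp.add_apply, coeff_mul_T,
    LaurentPolynomial.invert_apply, LaurentPolynomial.C_apply] at c0 c1 c2
  have hp₀ : p₀ = Polynomial.C (p₀.coeff 0) := by
    ext i
    rw [Polynomial.coeff_C]
    split_ifs with hi
    · rw [hi]
    · rw [← coeff_toLaurent_natCast, ← c0, coeff_toLaurent_of_neg _ (by lia)]
  have hq₀ : q₀ = Polynomial.C (p₀.coeff 0) := by
    ext i
    rw [Polynomial.coeff_C]
    split_ifs with hi
    · have := c0 0
      rw [neg_zero] at this
      rw [hi]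
      exact (coeff_toLaurent_natCast q₀ 0).symm.trans (this.trans (coeff_toLaurent_natCast p₀ 0))
    · have := c0 (-i)
      rw [neg_neg] at this
      rw [← coeff_toLaurent_natCast, this, coeff_toLaurent_of_neg _ (by lia)]
  have hp₁ : p₁ = 0 := by
    ext i
    rw [← coeff_toLaurent_natCast, ← c1, coeff_toLaurent_of_neg _ (by lia), Polynomial.coeff_zero]
  have hq₁ : q₁ = 0 := by
    ext i
    have := c1 (-i - 1)
    rw [show -(-(i : ℤ) - 1 - -1) = i by ring] at this
    rw [← coeff_toLaurent_natCast, this, coeff_toLaurent_of_neg _ (by lia), Polynomial.coeff_zero]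
  have hp₂ : p₂ = 0 := by
    ext i
    rw [← coeff_toLaurent_natCast, ← c2, coeff_toLaurent_of_neg _ (by lia), Polynomial.coeff_zero,
      if_neg (by lia), add_zero]
  have hq₂ : q₂ = 0 := by
    ext i
    have := c2 (-i - 2)
    rw [show -(-(i : ℤ) - 2 - -2) = i by ring, if_neg (by lia), zero_add] at this
    rw [← coeff_toLaurent_natCast, this, coeff_toLaurent_of_neg _ (by lia), Polynomial.coeff_zero]
  refine ⟨?_, p₀.coeff 0, ?_, ?_⟩
  · have := c2 (-1)
    rwa [if_pos (by norm_num), coeff_toLaurent_of_neg _ (by norm_num),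
      coeff_toLaurent_of_neg _ (by norm_num), add_zero] at this
  · rw [hp₁, hp₂, map_zero, zero_mul, zero_mul, add_zero, add_zero, hp₀, Polynomial.aeval_C,
      Polynomial.coeff_C_zero]
  · rw [hq₁, hq₂, map_zero, zero_mul, zero_mul, add_zero, add_zero, hq₀, Polynomial.aeval_C]

/-- `H¹(U, 𝒪)` is generated by the class of `y² / x`. -/
theorem exists_overlap_eq (f : Overlap) : ∃ (c : Base) (b₁ b₂ : Chart),
    f = c • (res₁ y ^ 2 * xinv) + res₂ b₂ - res₁ b₁ := by
  have h1 : res₁ x * xinv = 1 := x_mul_xinv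
  let S : Submodule Base Overlap := Submodule.span Base {res₁ y ^ 2 * xinv} ⊔
    LinearMap.range res₂.toLinearMap ⊔ LinearMap.range res₁.toLinearMap
  have hs₁ : ∀ b, res₁ b ∈ S := fun b => Submodule.mem_sup_right ⟨b, rfl⟩
  have hs₂ : ∀ b, res₂ b ∈ S := fun b => Submodule.mem_sup_left (Submodule.mem_sup_right ⟨b, rfl⟩)
  have hs₀ : res₁ y ^ 2 * xinv ∈ S :=
    Submodule.mem_sup_left (Submodule.mem_sup_left (Submodule.mem_span_singleton_self _))
  -- Monomials `xⁱ⁻ⁿyʲ`: if `n ≤ i`, they come from the first chart. If `n = i + m + 1`, they come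
  -- from the second one unless `j > m + 1`, which leaves only `j = 2`, `m = 0`.
  have hmon : ∀ i n j : ℕ, j ≤ 2 → res₁ x ^ i * xinv ^ n * res₁ y ^ j ∈ S := by
    intro i n j hj
    rcases le_or_gt n i with hni | hni
    · obtain ⟨m, rfl⟩ := Nat.exists_eq_add_of_le hni
      have := hs₁ (x ^ m * y ^ j)
      rwa [map_mul, map_pow, map_pow, ← one_mul (res₁ x ^ m), ← one_pow n, ← h1, mul_pow,
        mul_right_comm (res₁ x ^ n), ← pow_add] at this
    · obtain ⟨m, rfl⟩ := Nat.exists_eq_add_of_lt hni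
      have e : res₁ x ^ i * xinv ^ (i + m + 1) = xinv ^ (m + 1) := by
        rw [add_assoc, pow_add, ← mul_assoc, ← mul_pow, h1, one_pow, one_mul]
      rw [e]
      rcases le_or_gt j (m + 1) with hjm | hjm
      · obtain ⟨l, hl⟩ := Nat.exists_eq_add_of_le hjm
        have := hs₂ (x ^ l * y ^ j)
        rw [map_mul, map_pow, map_pow, res₂_x, res₂_y] at this
        rw [hl, pow_add]
        convert this using 1
        ring
      · obtain rfl : m = 0 := by lia
        obtain rfl : j = 2 := by lia
        rwa [zero_add, pow_one, mul_comm]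
  have hpoly : ∀ (p : Polynomial Base) (n j : ℕ), j ≤ 2 →
      res₁ (Polynomial.aeval x p) * xinv ^ n * res₁ y ^ j ∈ S := by
    intro p n j hj
    induction p using Polynomial.induction_on' with
    | add p q hp hq =>
      rw [map_add, map_add, add_mul, add_mul]
      exact S.add_mem hp hq
    | monomial i a =>
      rw [Polynomial.aeval_monomial, ← Algebra.smul_def, map_smul, map_pow, smul_mul_assoc,
        smul_mul_assoc]
      exact S.smul_mem _ (hmon _ _ _ hj)
  have hf : f ∈ S := by
    obtain ⟨n, b, hb⟩ := IsLocalization.Away.surj x f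
    have e : f = res₁ b * xinv ^ n := by
      have hb' : f * res₁ x ^ n = res₁ b := hb
      rw [← hb', mul_assoc, ← mul_pow, h1, one_pow, mul_one]
    obtain ⟨p₀, p₁, p₂, rfl⟩ := exists_chart_eq b
    rw [e]
    convert S.add_mem (S.add_mem (hpoly p₀ n 0 (by norm_num)) (hpoly p₁ n 1 (by norm_num)))
      (hpoly p₂ n 2 le_rfl) using 1
    simp only [map_add, map_mul, map_pow]
    ring
  obtain ⟨_, hu, _, ⟨b₁, rfl⟩, rfl⟩ := Submodule.mem_sup.mp hf
  obtain ⟨_, hv, _, ⟨b₂, rfl⟩, rfl⟩ := Submodule.mem_sup.mp hu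
  obtain ⟨c, rfl⟩ := Submodule.mem_span_singleton.mp hv
  exact ⟨c, -b₁, b₂, by rw [map_neg, sub_neg_eq_add]; rfl⟩

theorem res₁_injective : Function.Injective res₁ := by
  refine (injective_iff_map_eq_zero res₁).mpr fun b hb => ?_
  obtain ⟨-, a, ha, h0⟩ := eq_const_of_res_eq (c := 0) (b₁ := b) (b₂ := 0) (by
    rw [hb, zero_smul, map_zero, add_zero])
  rw [ha, ← h0]

theorem algebraMap_chart_injective : Function.Injective (algebraMap Base Chart) := by
  refine (injective_iff_map_eq_zero _).mpr fun a ha => ?_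
  obtain ⟨ψ, hC, -⟩ := exists_overlap_expansion
  have h := hC a
  rw [← AlgHom.commutes res₁, ha, map_zero, map_zero] at h
  obtain ⟨h0, -⟩ := laurent_linearIndependent (p := LaurentPolynomial.C a) (q := 0) (r := 0) (by
    rw [← h]; simp)
  simpa using congrArg (fun f : LaurentPolynomial Base => f.coeff 0) h0

/-! ### Relative forms -/

theorem exists_eq_smul_omega (α : Ω[Chart⁄Base]) : ∃ b : Chart, α = b • omega := by
  have h : α ∈ Submodule.span Chart (Set.range (KaehlerDifferential.D Base Chart)) := by
    rw [KaehlerDifferential.span_range_derivation]; trivial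
  have hle : Submodule.span Chart (Set.range (KaehlerDifferential.D Base Chart)) ≤
      Submodule.span Chart {omega} := by
    rw [Submodule.span_le]
    rintro _ ⟨b, rfl⟩
    obtain ⟨c, hc⟩ := D_mem_span_omega b
    exact Submodule.mem_span_singleton.mpr ⟨c, hc.symm⟩
  obtain ⟨b, hb⟩ := Submodule.mem_span_singleton.mp (hle h)
  exact ⟨b, hb.symm⟩

/-- The vector field along the fibres that is dual to `ω`. -/
theorem exists_vertical_derivation : ∃ D : Derivation ℂ Chart Chart,
    D tc = 0 ∧ D x = -(y ^ 2 - tc * x) ∧ D y = x ^ 2 - tc * y :=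
  exists_derivation_chart _ _ _ (by ring)

/-- A vertical vector field with value `1` on `ω`, both as a derivation over `ℂ` and over the base. -/
theorem exists_chart_dual_omega : ∃ D : Derivation ℂ Chart Chart, D tc = 0 ∧
    ∃ D' : Derivation Base Chart Chart, (∀ b, D' b = D b) ∧
      D'.liftKaehlerDifferential omega = 1 := by
  obtain ⟨D, ht, hx, hy⟩ := exists_vertical_derivation
  obtain ⟨D', hD'⟩ := exists_relative_derivation D ht
  refine ⟨D, ht, D', hD', eq_of_smul_eq ?_ ?_⟩
  · rw [← map_smul, omega_dy, Derivation.liftKaehlerDifferential_comp_D, hD', hy, smul_eq_mul,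
      mul_one]
  · rw [← map_smul, omega_dx, map_neg, Derivation.liftKaehlerDifferential_comp_D, hD', hx,
      smul_eq_mul, mul_one, neg_neg]

theorem smul_pullback_omega_injective {f : Overlap} (h : f • pullback res₁ omega = 0) : f = 0 := by
  obtain ⟨D, ht, hx, hy⟩ := exists_vertical_derivation
  obtain ⟨E, hE⟩ := exists_derivation_overlap D
  obtain ⟨E', hE'⟩ := exists_relative_derivation E (by
    rw [← AlgHom.commutes res₁, hE, ht, map_zero])
  have h1 : E'.liftKaehlerDifferential (pullback res₁ omega) = 1 := by
    have hsmul : ∀ (b : Chart) (c : Overlap), b • c = res₁ b • c := fun b c =>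
      Algebra.smul_def b c
    refine eq_of_smul_eq ?_ ?_
    · rw [hsmul, hsmul, ← map_smul, ← pullback_smul, omega_dy, pullback_D,
        Derivation.liftKaehlerDifferential_comp_D, hE', hE, hy, smul_eq_mul, mul_one]
    · rw [hsmul, hsmul, ← map_smul, ← pullback_smul, omega_dx, map_neg, pullback_D, map_neg,
        Derivation.liftKaehlerDifferential_comp_D, hE', hE, hx, smul_eq_mul, mul_one, map_neg,
        neg_neg]
  have h2 := congrArg E'.liftKaehlerDifferential h
  rwa [map_smul, h1, map_zero, smul_eq_mul, mul_one] at h2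

theorem smul_omega_injective {b : Chart} (h : b • omega = 0) : b = 0 := by
  apply res₁_injective
  rw [map_zero]
  refine smul_pullback_omega_injective ?_
  rw [← pullback_smul, h, map_zero]

/-! ### The basis of the cohomology -/

theorem smul_classes_eq_zero {a b : Base} (h : a • omegaClass + b • etaClass = 0) :
    a = 0 ∧ b = 0 := by
  rw [omegaClass, etaClass, ← map_smul, ← map_smul, ← map_add,
    ← map_zero (cohomologyClass res₁ res₂), cohomologyClass_eq_iff] at h
  obtain ⟨⟨b₁, b₂⟩, h⟩ := h
  rw [ZeroMemClass.coe_zero, sub_zero] at h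
  have h₁ : KaehlerDifferential.D Base Chart b₁ = a • omega + b • ((x * y) • omega) :=
    congrArg Prod.fst h
  have h₃ : res₂ b₂ - res₁ b₁ = a • (0 : Overlap) + b • (-(res₁ y ^ 2 * xinv)) :=
    congrArg (fun z => z.2.2) h
  rw [smul_zero, zero_add, smul_neg, sub_eq_iff_eq_add] at h₃
  obtain ⟨hb, r, hr, -⟩ := eq_const_of_res_eq (c := b) (b₁ := b₁) (b₂ := b₂) (by
    rw [h₃]; abel)
  refine ⟨?_, hb⟩
  rw [hb, zero_smul, add_zero, hr, Derivation.map_algebraMap, ← algebraMap_smul Chart a] at h₁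
  refine algebraMap_chart_injective ?_
  rw [map_zero]
  exact smul_omega_injective h₁.symm

theorem exists_eq_smul_classes (c : HesseH1) : ∃ a b : Base, c = a • omegaClass + b • etaClass := by
  obtain ⟨⟨⟨α₁, α₂, f⟩, hz⟩, rfl⟩ := Submodule.mkQ_surjective _ c
  obtain ⟨e, b₁, b₂, hf⟩ := exists_overlap_eq f
  -- Modulo a coboundary and a multiple of `η`, the component on the overlap is zero.
  obtain ⟨β₁, h₁⟩ := exists_eq_smul_omega
    (α₁ + e • ((x * y) • omega) - KaehlerDifferential.D Base Chart b₁)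
  obtain ⟨β₂, h₂⟩ := exists_eq_smul_omega
    (α₂ + e • ((x * y) • (-omega)) - KaehlerDifferential.D Base Chart b₂)
  have hcocycle : ((β₁ • omega, β₂ • omega, 0) : Cochain1 Base Chart Chart Overlap) =
      (α₁, α₂, f) + e • (etaCocycle : Cochain1 Base Chart Chart Overlap) -
        d0 res₁ res₂ (b₁, b₂) := by
    rw [← h₁, ← h₂, d0_apply, hf]
    refine Prod.ext rfl (Prod.ext rfl ?_)
    change (0 : Overlap) = e • (res₁ y ^ 2 * xinv) + res₂ b₂ - res₁ b₁ +
      e • (-(res₁ y ^ 2 * xinv)) - (res₂ b₂ - res₁ b₁)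
    rw [smul_neg]
    abel
  have hd : d1 res₁ res₂ (β₁ • omega, β₂ • omega, 0) = 0 := by
    rw [hcocycle, map_sub, map_add, map_smul, d1_d0, LinearMap.mem_ker.mp etaCocycle.2,
      LinearMap.mem_ker.mp hz, smul_zero, add_zero, sub_zero]
  have h₃ : pullback res₂ (β₂ • omega) - pullback res₁ (β₁ • omega) -
      KaehlerDifferential.D Base Overlap 0 = 0 := congrArg (fun z => z.2.2) hd
  rw [map_zero, sub_zero, pullback_smul, pullback_smul, res₂_omega, smul_neg, ← neg_smul,
    ← sub_smul] at h₃
  obtain ⟨-, a, ha₁, ha₂⟩ := eq_const_of_res_eq (c := 0) (b₁ := β₁) (b₂ := -β₂) (by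
    rw [zero_smul, zero_add, map_neg]
    exact sub_eq_zero.mp (smul_pullback_omega_injective h₃))
  refine ⟨a, -e, ?_⟩
  rw [omegaClass, etaClass, ← map_smul, ← map_smul, ← map_add]
  refine (cohomologyClass_eq_iff _ _ _ _).mpr ⟨(b₁, b₂), ?_⟩
  have hω : a • (omegaCocycle : Cochain1 Base Chart Chart Overlap) =
      (β₁ • omega, β₂ • omega, 0) := by
    refine Prod.ext ?_ (Prod.ext ?_ (smul_zero a))
    · rw [ha₁, algebraMap_smul]; rfl
    · rw [← neg_neg β₂, ha₂, neg_smul, algebraMap_smul]; exact smul_neg _ _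
  change d0 res₁ res₂ (b₁, b₂) = (α₁, α₂, f) -
    (a • (omegaCocycle : Cochain1 Base Chart Chart Overlap) +
      (-e) • (etaCocycle : Cochain1 Base Chart Chart Overlap))
  rw [hω, hcocycle]
  module

theorem exists_basis :
    ∃ e : Module.Basis (Fin 2) Base HesseH1, e 0 = omegaClass ∧ e 1 = etaClass := by
  have hli : LinearIndependent Base ![omegaClass, etaClass] :=
    LinearIndependent.pair_iff.mpr fun a b h => smul_classes_eq_zero h
  refine ⟨Module.Basis.mk hli ?_, Module.Basis.mk_apply _ _ 0, Module.Basis.mk_apply _ _ 1⟩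
  intro c _
  obtain ⟨a, b, rfl⟩ := exists_eq_smul_classes c
  exact add_mem (Submodule.smul_mem _ _ (Submodule.subset_span ⟨0, rfl⟩))
    (Submodule.smul_mem _ _ (Submodule.subset_span ⟨1, rfl⟩))

/-! ### Uniqueness of the Gauss–Manin derivative -/

/-- Injectivity of `dt ∧ -` on relative cochains of degree 1. -/
theorem toRelative_eq_zero_of_baseWedge (w : Cochain1 ℂ Chart Chart Overlap)
    (h : baseWedge (KaehlerDifferential.D ℂ Base t) w = 0) :
    toRelative ℂ Base Chart Chart Overlap w = 0 := by
  obtain ⟨β₁, β₂, g⟩ := w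
  obtain ⟨Dt, hDt, -, -⟩ := exists_derivation_chart 1
    (algebraMap Base Chart invDisc * coefA * (x * y))
    (algebraMap Base Chart invDisc * coefB * (x * y)) (by
      linear_combination x * y * algebraMap Base Chart invDisc * coef_relation + x * y * tc_invDisc)
  -- With a lift `Dt` of `∂/∂t` and a vertical field `D` dual to `ω`, the value of `dt ∧ β` on
  -- `(Dt, D)` is `β(D)`, the coefficient of `ω` in the restriction of `β` to the fibres.
  have hchart : ∀ β : Ω[Chart⁄ℂ], wedge (KaehlerDifferential.D ℂ Chart tc) β = 0 →
      KaehlerDifferential.map ℂ Base Chart Chart β = 0 := by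
    intro β hβ
    obtain ⟨D, ht, D', hD', hω⟩ := exists_chart_dual_omega
    have h1 := congrArg (evalTwoForm Dt D) hβ
    rw [evalTwoForm_wedge, Derivation.liftKaehlerDifferential_comp_D,
      Derivation.liftKaehlerDifferential_comp_D, hDt, ht, one_mul, zero_mul, sub_zero,
      map_zero] at h1
    have h2 : D'.liftKaehlerDifferential.comp (KaehlerDifferential.map ℂ Base Chart Chart) =
        D.liftKaehlerDifferential := by
      refine Derivation.liftKaehlerDifferential_unique _ _ ?_
      ext b
      simp [hD']
    have h3 := LinearMap.congr_fun h2 β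
    obtain ⟨b, hb⟩ := exists_eq_smul_omega (KaehlerDifferential.map ℂ Base Chart Chart β)
    rw [LinearMap.comp_apply, hb, map_smul, hω, h1, smul_eq_mul, mul_one] at h3
    rw [hb, h3, zero_smul]
  have h₁ : wedge (KaehlerDifferential.map ℂ ℂ Base Chart
      (KaehlerDifferential.D ℂ Base t)) β₁ = 0 :=
    congrArg Prod.fst h
  have h₂ : wedge (KaehlerDifferential.map ℂ ℂ Base Chart
      (KaehlerDifferential.D ℂ Base t)) β₂ = 0 :=
    congrArg (fun z => z.2.1) h
  have h₃ : -(g • KaehlerDifferential.map ℂ ℂ Base Overlap (KaehlerDifferential.D ℂ Base t)) = 0 :=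
    congrArg (fun z => z.2.2) h
  rw [map_base_D] at h₁ h₂ h₃
  refine Prod.ext (hchart _ h₁) (Prod.ext (hchart _ h₂) ?_)
  obtain ⟨E, hE⟩ := exists_derivation_overlap Dt
  have h4 := congrArg E.liftKaehlerDifferential h₃
  rw [map_neg, map_smul, Derivation.liftKaehlerDifferential_comp_D, ← AlgHom.commutes res₁, hE, hDt,
    map_one, map_zero, smul_eq_mul, mul_one, neg_eq_zero] at h4
  exact h4

theorem isGaussManin_unique {c : HesseH1} {s s' : Ω[Base⁄ℂ] ⊗[Base] HesseH1}
    (h : IsGaussManin ℂ res₁ res₂ c s) (h' : IsGaussManin ℂ res₁ res₂ c s') : s = s' := by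
  have h0 := h.sub h'
  rw [sub_self] at h0
  exact sub_eq_zero.mp (h0.eq_zero t exists_eq_smul_D_t toRelative_eq_zero_of_baseWedge)

/-! ### Absolute forms on a chart -/

/-- The function `1 / (1 - t³)` on a chart. -/
abbrev invDiscC : Chart := algebraMap Base Chart invDisc

/-- The absolute form on a chart that restricts to `ω` on the fibres and vanishes on the lift
`∂` of `∂/∂t` with `(1 - t³) ∂x = -y (x² - ty)` and `(1 - t³) ∂y = y (t² - xy)`. Adding a
multiple `b dt` would give another lift of `ω`; this one is chosen so that `extDeriv_absOmega` and
`pullback_absOmega` hold without correction terms. -/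
def absOmega : Ω[Chart⁄ℂ] :=
  invDiscC •
    (coefA • (KaehlerDifferential.D ℂ Chart y -
        (invDiscC * y * (tc ^ 2 - x * y)) • KaehlerDifferential.D ℂ Chart tc) -
      coefB • (KaehlerDifferential.D ℂ Chart x +
        (invDiscC * y * (x ^ 2 - tc * y)) • KaehlerDifferential.D ℂ Chart tc))

theorem map_absOmega : KaehlerDifferential.map ℂ Base Chart Chart absOmega = omega := by
  simp only [absOmega, omega, map_smul, map_sub, map_add, KaehlerDifferential.map_D]
  have h : KaehlerDifferential.D Base Chart (algebraMap Chart Chart tc) = 0 :=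
    Derivation.map_algebraMap _ t
  rw [h, smul_zero, smul_zero, sub_zero, add_zero]
  rfl

/-- The differential of the equation of the total space; compare `differential_relation`. -/
theorem abs_differential_relation :
    (x ^ 2 - tc * y) • KaehlerDifferential.D ℂ Chart x +
      (y ^ 2 - tc * x) • KaehlerDifferential.D ℂ Chart y =
        (x * y) • KaehlerDifferential.D ℂ Chart tc := by
  have h3 : algebraMap ℂ Chart 3⁻¹ * 3 = 1 := by
    rw [← map_ofNat (algebraMap ℂ Chart) 3, ← map_mul]
    norm_num
  have h : KaehlerDifferential.D ℂ Chart (x ^ 3 + y ^ 3 + 1) =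
      KaehlerDifferential.D ℂ Chart (tc * x * y + tc * x * y + tc * x * y) := by
    rw [chart_relation]
    congr 1
    ring
  simp only [map_add, Derivation.leibniz_pow, Derivation.map_one_eq_zero, Derivation.leibniz,
    add_zero] at h
  rw [← sub_eq_zero, ← one_smul Chart (_ - _), ← h3, mul_smul]
  refine (congrArg _ ?_).trans (smul_zero _)
  rw [← sub_eq_zero] at h
  rw [← h]
  simp only [← Nat.cast_smul_eq_nsmul Chart]
  push_cast
  module

theorem absOmega_dy : (x ^ 2 - tc * y) • absOmega = KaehlerDifferential.D ℂ Chart y -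
    (invDiscC * y * (tc ^ 2 - x * y)) • KaehlerDifferential.D ℂ Chart tc := by
  have h : (x ^ 2 - tc * y) • absOmega - (KaehlerDifferential.D ℂ Chart y -
      (invDiscC * y * (tc ^ 2 - x * y)) • KaehlerDifferential.D ℂ Chart tc) +
      (invDiscC * coefB) • ((x ^ 2 - tc * y) • KaehlerDifferential.D ℂ Chart x +
      (y ^ 2 - tc * x) • KaehlerDifferential.D ℂ Chart y -
        (x * y) • KaehlerDifferential.D ℂ Chart tc) = 0 := by
    rw [absOmega]
    match_scalars
    · linear_combination invDiscC * coef_relation + tc_invDisc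
    · linear_combination
        (-(invDiscC * (invDiscC * y * (tc ^ 2 - x * y)))) * coef_relation +
        (-(invDiscC * y * (tc ^ 2 - x * y)) + invDiscC * coefB * x * y) * tc_invDisc
        - invDiscC ^ 2 * coefB * y * x * chart_relation
    · ring
  rwa [abs_differential_relation, sub_self, smul_zero, add_zero, sub_eq_zero] at h

theorem absOmega_dx : (y ^ 2 - tc * x) • absOmega = -KaehlerDifferential.D ℂ Chart x -
    (invDiscC * y * (x ^ 2 - tc * y)) • KaehlerDifferential.D ℂ Chart tc := by
  have h : (y ^ 2 - tc * x) • absOmega - (-KaehlerDifferential.D ℂ Chart x -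
      (invDiscC * y * (x ^ 2 - tc * y)) • KaehlerDifferential.D ℂ Chart tc) -
      (invDiscC * coefA) • ((x ^ 2 - tc * y) • KaehlerDifferential.D ℂ Chart x +
      (y ^ 2 - tc * x) • KaehlerDifferential.D ℂ Chart y -
        (x * y) • KaehlerDifferential.D ℂ Chart tc) = 0 := by
    rw [absOmega]
    match_scalars
    · ring
    · linear_combination
        (-(invDiscC * (invDiscC * y * (x ^ 2 - tc * y)))) * coef_relation +
        (-(invDiscC * y * (x ^ 2 - tc * y)) - invDiscC * coefA * x * y) * tc_invDisc
        + invDiscC ^ 2 * coefA * y * x * chart_relation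
    · linear_combination -invDiscC * coef_relation - tc_invDisc
  rwa [abs_differential_relation, sub_self, smul_zero, sub_zero, sub_eq_zero] at h

theorem D_y_eq : KaehlerDifferential.D ℂ Chart y =
    (invDiscC * y * (tc ^ 2 - x * y)) • KaehlerDifferential.D ℂ Chart tc +
      (x ^ 2 - tc * y) • absOmega := by
  rw [absOmega_dy]; abel

theorem D_x_eq : KaehlerDifferential.D ℂ Chart x =
    (-(invDiscC * y * (x ^ 2 - tc * y))) • KaehlerDifferential.D ℂ Chart tc +
      (-(y ^ 2 - tc * x)) • absOmega := by
  rw [neg_smul (y ^ 2 - tc * x), absOmega_dx, neg_smul]; abel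

/-- Functions of `t` have differentials proportional to `dt`. -/
theorem exists_D_invDisc_eq : ∃ r : Chart, KaehlerDifferential.D ℂ Chart invDiscC =
    r • KaehlerDifferential.D ℂ Chart tc := by
  obtain ⟨a, ha⟩ := exists_eq_smul_D_t (KaehlerDifferential.D ℂ Base invDisc)
  refine ⟨algebraMap Base Chart a, ?_⟩
  rw [← map_base_D, ha, map_base_smul, map_base_D]

/-- Obtained from the exterior derivatives of `absOmega_dy` and `absOmega_dx`, which determine that
of `absOmega` because `x² - ty` and `y² - tx` generate the unit ideal. -/
theorem extDeriv_absOmega : extDeriv ℂ Chart absOmega =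
    (invDiscC * (tc ^ 2 - x * y)) • wedge (KaehlerDifferential.D ℂ Chart tc) absOmega := by
  obtain ⟨r, hr⟩ := exists_D_invDisc_eq
  refine eq_of_smul_eq ?_ ?_
  · have h := congrArg (extDeriv ℂ Chart) absOmega_dy
    rw [extDeriv_leibniz, LinearMap.map_sub (extDeriv ℂ Chart), extDeriv_D,
      extDeriv_leibniz, extDeriv_D] at h
    have hP : KaehlerDifferential.D ℂ Chart (x ^ 2 - tc * y) =
        (2 * x * -(invDiscC * y * (x ^ 2 - tc * y)) - tc * (invDiscC * y * (tc ^ 2 - x * y)) - y) •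
          KaehlerDifferential.D ℂ Chart tc +
        (2 * x * -(y ^ 2 - tc * x) - tc * (x ^ 2 - tc * y)) • absOmega := by
      simp only [map_sub, Derivation.leibniz, Derivation.leibniz_pow, D_x_eq, D_y_eq]
      match_scalars <;> ring
    -- Only the component along `absOmega` matters, since the form gets wedged with `dt`.
    obtain ⟨s, hY⟩ : ∃ s, KaehlerDifferential.D ℂ Chart (invDiscC * y * (tc ^ 2 - x * y)) =
        s • KaehlerDifferential.D ℂ Chart tc +
        (invDiscC * ((x ^ 2 - tc * y) * (tc ^ 2 - 2 * x * y) + y ^ 2 * (y ^ 2 - tc * x))) •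
          absOmega := by
      refine ⟨r * (y * (tc ^ 2 - x * y)) + invDiscC * ((tc ^ 2 - 2 * x * y) *
        (invDiscC * y * (tc ^ 2 - x * y)) + y ^ 2 * (invDiscC * y * (x ^ 2 - tc * y)) +
          2 * tc * y), ?_⟩
      simp only [map_sub, Derivation.leibniz, Derivation.leibniz_pow, D_x_eq, D_y_eq, hr]
      match_scalars <;> ring
    rw [hP, hY] at h
    simp only [wedge_add_left, wedge_smul_left, wedge_self, smul_zero, add_zero, zero_add,
      zero_sub] at h
    rw [wedge_swap absOmega] at h
    rw [← eq_sub_iff_add_eq'] at h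
    rw [h]
    match_scalars
    linear_combination invDiscC * y * chart_relation - y * tc_invDisc
  · have h := congrArg (extDeriv ℂ Chart) absOmega_dx
    rw [extDeriv_leibniz, LinearMap.map_sub (extDeriv ℂ Chart), LinearMap.map_neg (extDeriv ℂ Chart),
      extDeriv_D, extDeriv_leibniz, extDeriv_D] at h
    have hQ : KaehlerDifferential.D ℂ Chart (y ^ 2 - tc * x) =
        (2 * y * (invDiscC * y * (tc ^ 2 - x * y)) + tc * (invDiscC * y * (x ^ 2 - tc * y)) - x) •
          KaehlerDifferential.D ℂ Chart tc +
        (2 * y * (x ^ 2 - tc * y) + tc * (y ^ 2 - tc * x)) • absOmega := by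
      simp only [map_sub, Derivation.leibniz, Derivation.leibniz_pow, D_x_eq, D_y_eq]
      match_scalars <;> ring
    obtain ⟨s, hX⟩ : ∃ s, KaehlerDifferential.D ℂ Chart (invDiscC * y * (x ^ 2 - tc * y)) =
        s • KaehlerDifferential.D ℂ Chart tc +
        (invDiscC * ((x ^ 2 - tc * y) * (x ^ 2 - 2 * tc * y) - 2 * x * y * (y ^ 2 - tc * x))) •
          absOmega := by
      refine ⟨r * (y * (x ^ 2 - tc * y)) + invDiscC * ((x ^ 2 - 2 * tc * y) *
        (invDiscC * y * (tc ^ 2 - x * y)) - 2 * x * y * (invDiscC * y * (x ^ 2 - tc * y)) -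
          y ^ 2), ?_⟩
      simp only [map_sub, Derivation.leibniz, Derivation.leibniz_pow, D_x_eq, D_y_eq, hr]
      match_scalars <;> ring
    rw [hQ, hX] at h
    simp only [wedge_add_left, wedge_smul_left, wedge_self, smul_zero, add_zero, zero_add,
      neg_zero, zero_sub] at h
    rw [wedge_swap absOmega] at h
    rw [← eq_sub_iff_add_eq'] at h
    rw [h]
    match_scalars
    linear_combination invDiscC * x * chart_relation - x * tc_invDisc

/-! ### Comparison of the absolute forms on the overlap -/

theorem eq_zero_of_res₂_smul {M : Type*} [AddCommGroup M] [Module Overlap M] {γ : M}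
    (hp : res₂ (x ^ 2 - tc * y) • γ = 0) (hq : res₂ (y ^ 2 - tc * x) • γ = 0) : γ = 0 := by
  have key : γ = res₂ (invDiscC * coefA) • (res₂ (x ^ 2 - tc * y) • γ) +
      res₂ (invDiscC * coefB) • (res₂ (y ^ 2 - tc * x) • γ) := by
    rw [smul_smul, smul_smul, ← add_smul, ← map_mul, ← map_mul, ← map_add, mul_assoc, mul_assoc,
      ← mul_add, coef_relation, mul_comm, tc_invDisc, map_one, one_smul]
  rw [key, hp, hq, smul_zero, smul_zero, add_zero]

theorem D_xinv_abs : KaehlerDifferential.D ℂ Overlap xinv =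
    -(xinv ^ 2 • KaehlerDifferential.D ℂ Overlap (res₁ x)) := by
  have h1 : res₁ x * xinv = 1 := x_mul_xinv
  have h := congrArg (KaehlerDifferential.D ℂ Overlap) h1
  rw [Derivation.leibniz, Derivation.map_one_eq_zero] at h
  have h2 : KaehlerDifferential.D ℂ Overlap xinv =
      xinv • (res₁ x • KaehlerDifferential.D ℂ Overlap xinv) := by
    rw [smul_smul, mul_comm, h1, one_smul]
  rw [h2, eq_neg_of_add_eq_zero_left h, smul_neg, smul_smul, sq]

/-- The relation of `res₂_omega` acquires a term in `dt` for the absolute forms; its coefficient is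
the component of the cocycle of `η` on the overlap, up to the factor `-1 / (1 - t³)`. -/
theorem pullback_absOmega :
    pullback (res₂.restrictScalars ℂ) absOmega + pullback (res₁.restrictScalars ℂ) absOmega =
      (algebraMap Base Overlap invDisc * (res₁ y ^ 2 * xinv)) •
        KaehlerDifferential.D ℂ Overlap (algebraMap Base Overlap t) := by
  have h1 : res₁ x * xinv = 1 := x_mul_xinv
  have hr := congrArg res₁ chart_relation
  simp only [map_add, map_mul, map_pow, map_one, map_ofNat, AlgHom.commutes] at hr
  have hp₁ := congrArg (pullback (res₁.restrictScalars ℂ)) D_y_eq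
  have hq₁ := congrArg (pullback (res₁.restrictScalars ℂ)) D_x_eq
  have hp₂ := congrArg (pullback (res₂.restrictScalars ℂ)) absOmega_dy
  have hq₂ := congrArg (pullback (res₂.restrictScalars ℂ)) absOmega_dx
  simp only [map_add, map_sub, map_neg, pullback_smul, pullback_D, map_mul, map_pow,
    AlgHom.coe_restrictScalars', AlgHom.commutes, res₂_x, res₂_y] at hp₁ hq₁ hp₂ hq₂
  rw [Derivation.leibniz, D_xinv_abs, hp₁, hq₁] at hp₂
  rw [D_xinv_abs, hq₁] at hq₂
  rw [← sub_eq_zero]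
  refine eq_zero_of_res₂_smul ?_ ?_
  · simp only [map_sub, map_mul, map_pow, AlgHom.commutes, res₂_x, res₂_y]
    rw [smul_sub, smul_add, hp₂]
    match_scalars
    · linear_combination (algebraMap Base Overlap invDisc * xinv * res₁ y ^ 2 * res₁ x) * h1
    · linear_combination xinv ^ 2 * hr +
        (2 * res₁ y * xinv * algebraMap Base Overlap t - xinv * res₁ x ^ 2) * h1
  · simp only [map_sub, map_mul, map_pow, AlgHom.commutes, res₂_x, res₂_y]
    rw [smul_sub, smul_add, hq₂]
    match_scalars
    · linear_combination (-(algebraMap Base Overlap invDisc * res₁ y * xinv ^ 3)) * hr +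
        (algebraMap Base Overlap invDisc * res₁ y * xinv ^ 2 *
          (-3 * algebraMap Base Overlap t * res₁ y + res₁ x ^ 2)) * h1
    · linear_combination algebraMap Base Overlap t * xinv * h1

/-! ### The Gauss–Manin derivatives of `ω` and `η` -/

theorem map_dtOverDisc_chart : KaehlerDifferential.map ℂ ℂ Base Chart dtOverDisc =
    invDiscC • KaehlerDifferential.D ℂ Chart tc := by
  rw [dtOverDisc, map_base_smul, map_base_D]

theorem map_dtOverDisc_overlap : KaehlerDifferential.map ℂ ℂ Base Overlap dtOverDisc =
    algebraMap Base Overlap invDisc •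
      KaehlerDifferential.D ℂ Overlap (algebraMap Base Overlap t) := by
  rw [dtOverDisc, map_base_smul, map_base_D]

/-- The absolute lift of the relative cocycle `a ω + b η` built from `absOmega`. -/
def liftCocycle (a b : Base) : Cochain1 ℂ Chart Chart Overlap :=
  ((algebraMap Base Chart a + algebraMap Base Chart b * (x * y)) • absOmega,
    -((algebraMap Base Chart a + algebraMap Base Chart b * (x * y)) • absOmega),
    -(algebraMap Base Overlap b * (res₁ y ^ 2 * xinv)))

theorem toRelative_liftCocycle (a b : Base) :
    toRelative ℂ Base Chart Chart Overlap (liftCocycle a b) =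
      ((a • omegaCocycle + b • etaCocycle : Cocycle1 res₁ res₂) :
        Cochain1 Base Chart Chart Overlap) := by
  have h : (algebraMap Base Chart a + algebraMap Base Chart b * (x * y)) • omega =
      a • omega + b • ((x * y) • omega) := by
    rw [add_smul, mul_smul, algebraMap_smul, algebraMap_smul]
  refine Prod.ext ?_ (Prod.ext ?_ ?_)
  · change KaehlerDifferential.map ℂ Base Chart Chart (_ • absOmega) =
      a • omega + b • ((x * y) • omega)
    rw [map_smul, map_absOmega, h]
  · change KaehlerDifferential.map ℂ Base Chart Chart (-(_ • absOmega)) =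
      a • (-omega) + b • ((x * y) • (-omega))
    rw [map_neg, map_smul, map_absOmega, h, smul_neg, smul_neg, smul_neg, neg_add]
  · change -(algebraMap Base Overlap b * (res₁ y ^ 2 * xinv)) =
      a • (0 : Overlap) + b • (-(res₁ y ^ 2 * xinv))
    rw [smul_zero, zero_add, smul_neg, Algebra.smul_def]

/-- The defining property of the connecting homomorphism for a single term `dt / (1 - t³) ∧ -`. -/
theorem isGaussManin_of_d1_eq (z : Cocycle1 res₁ res₂) (zt : Cochain1 ℂ Chart Chart Overlap)
    (hz : toRelative ℂ Base Chart Chart Overlap zt = z) (a b : Base)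
    (h : d1 (res₁.restrictScalars ℂ) (res₂.restrictScalars ℂ) zt =
      baseWedge dtOverDisc (liftCocycle a b)) :
    IsGaussManin ℂ res₁ res₂ (cohomologyClass res₁ res₂ z)
      (dtOverDisc ⊗ₜ[Base] (a • omegaClass + b • etaClass)) := by
  refine ⟨z, zt, 1, fun _ => dtOverDisc, fun _ => a • omegaCocycle + b • etaCocycle,
    fun _ => liftCocycle a b, rfl, hz, fun _ => toRelative_liftCocycle a b, ?_, ?_⟩
  · rw [h, Fin.sum_univ_one]
  · rw [Fin.sum_univ_one, map_add, map_smul, map_smul]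
    rfl

theorem baseWedge_liftCocycle (a b : Base) : baseWedge dtOverDisc (liftCocycle a b) =
    ((invDiscC * (algebraMap Base Chart a + algebraMap Base Chart b * (x * y))) •
        wedge (KaehlerDifferential.D ℂ Chart tc) absOmega,
      -((invDiscC * (algebraMap Base Chart a + algebraMap Base Chart b * (x * y))) •
        wedge (KaehlerDifferential.D ℂ Chart tc) absOmega),
      (algebraMap Base Overlap b * (res₁ y ^ 2 * xinv) * algebraMap Base Overlap invDisc) •
        KaehlerDifferential.D ℂ Overlap (algebraMap Base Overlap t)) := by
  rw [baseWedge, liftCocycle, map_dtOverDisc_chart, map_dtOverDisc_overlap]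
  simp only [wedge_neg_right, wedge_smul_left, wedge_smul_right, smul_smul, neg_mul, neg_smul,
    neg_neg]
  rw [mul_comm invDiscC]

theorem isGaussManin_omegaClass : IsGaussManin ℂ res₁ res₂ omegaClass
    (dtOverDisc ⊗ₜ[Base] (t ^ 2 • omegaClass + (-1 : Base) • etaClass)) := by
  refine isGaussManin_of_d1_eq omegaCocycle (absOmega, -absOmega, 0) ?_ _ _ ?_
  · refine Prod.ext map_absOmega (Prod.ext ?_ rfl)
    exact (map_neg _ _).trans (congrArg Neg.neg map_absOmega)
  · rw [baseWedge_liftCocycle, d1_apply, map_neg, map_neg, extDeriv_absOmega, map_zero, sub_zero,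
      ← neg_add', pullback_absOmega]
    have e : invDiscC * (algebraMap Base Chart (t ^ 2) + algebraMap Base Chart (-1) * (x * y)) =
        invDiscC * (tc ^ 2 - x * y) := by
      rw [map_pow, map_neg, map_one]
      ring
    rw [e, map_neg, map_one]
    refine Prod.ext rfl (Prod.ext rfl ?_)
    change -((_ : Overlap) • _) = (_ : Overlap) • _
    module

/-- The exterior derivative of the lift of `η` that is corrected by a multiple of `dt`. -/
theorem extDeriv_eta_lift :
    extDeriv ℂ Chart ((x * y) • absOmega +
      (invDiscC * (tc * x * y - y ^ 3)) • KaehlerDifferential.D ℂ Chart tc) =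
    (invDiscC * (tc - tc ^ 2 * (x * y))) • wedge (KaehlerDifferential.D ℂ Chart tc) absOmega := by
  obtain ⟨r, hr⟩ := exists_D_invDisc_eq
  have h1 : KaehlerDifferential.D ℂ Chart (x * y) =
      (x * (invDiscC * y * (tc ^ 2 - x * y)) - y * (invDiscC * y * (x ^ 2 - tc * y))) •
        KaehlerDifferential.D ℂ Chart tc + (x ^ 3 - y ^ 3) • absOmega := by
    simp only [Derivation.leibniz, D_x_eq, D_y_eq]
    match_scalars <;> ring
  obtain ⟨s, h2⟩ : ∃ s, KaehlerDifferential.D ℂ Chart (invDiscC * (tc * x * y - y ^ 3)) =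
      s • KaehlerDifferential.D ℂ Chart tc +
        (invDiscC * (tc * (x ^ 3 - y ^ 3) - 3 * y ^ 2 * (x ^ 2 - tc * y))) • absOmega := by
    refine ⟨r * (tc * x * y - y ^ 3) + invDiscC * (x * y +
      tc * (x * (invDiscC * y * (tc ^ 2 - x * y)) - y * (invDiscC * y * (x ^ 2 - tc * y))) -
        3 * y ^ 2 * (invDiscC * y * (tc ^ 2 - x * y))), ?_⟩
    simp only [map_sub, Derivation.leibniz, Derivation.leibniz_pow, D_x_eq, D_y_eq, hr]
    match_scalars <;> ring
  rw [map_add, extDeriv_leibniz, extDeriv_leibniz, extDeriv_D, extDeriv_absOmega, h1, h2]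
  simp only [wedge_add_left, wedge_smul_left, wedge_self, smul_zero, add_zero, zero_add]
  rw [wedge_swap absOmega]
  match_scalars
  linear_combination -invDiscC * tc * chart_relation

theorem isGaussManin_etaClass : IsGaussManin ℂ res₁ res₂ etaClass
    (dtOverDisc ⊗ₜ[Base] (t • omegaClass + (-t ^ 2) • etaClass)) := by
  refine isGaussManin_of_d1_eq etaCocycle
    ((x * y) • absOmega + (invDiscC * (tc * x * y - y ^ 3)) • KaehlerDifferential.D ℂ Chart tc,
      -((x * y) • absOmega +
        (invDiscC * (tc * x * y - y ^ 3)) • KaehlerDifferential.D ℂ Chart tc),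
      -(res₁ y ^ 2 * xinv)) ?_ _ _ ?_
  · have h : KaehlerDifferential.map ℂ Base Chart Chart ((x * y) • absOmega +
        (invDiscC * (tc * x * y - y ^ 3)) • KaehlerDifferential.D ℂ Chart tc) =
          (x * y) • omega := by
      rw [map_add, map_smul, map_smul, map_absOmega, KaehlerDifferential.map_D]
      have h0 : KaehlerDifferential.D Base Chart (algebraMap Chart Chart tc) = 0 :=
        Derivation.map_algebraMap _ t
      rw [h0, smul_zero, add_zero]
    refine Prod.ext h (Prod.ext ?_ rfl)
    exact (map_neg _ _).trans ((congrArg Neg.neg h).trans (smul_neg _ _).symm)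
  · rw [baseWedge_liftCocycle, d1_apply, map_neg (extDeriv ℂ Chart), extDeriv_eta_lift]
    have e : invDiscC * (algebraMap Base Chart t + algebraMap Base Chart (-t ^ 2) * (x * y)) =
        invDiscC * (tc - tc ^ 2 * (x * y)) := by
      rw [map_neg, map_pow]
      ring
    rw [e]
    refine Prod.ext rfl (Prod.ext rfl ?_)
    have h1 : res₁ x * xinv = 1 := x_mul_xinv
    have hr := congrArg res₁ chart_relation
    simp only [map_add, map_mul, map_pow, map_one, map_ofNat, AlgHom.commutes] at hr
    have hp₁ := congrArg (pullback (res₁.restrictScalars ℂ)) D_y_eq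
    have hq₁ := congrArg (pullback (res₁.restrictScalars ℂ)) D_x_eq
    simp only [map_add, map_sub, map_neg, pullback_smul, pullback_D, map_mul, map_pow,
      AlgHom.coe_restrictScalars', AlgHom.commutes] at hp₁ hq₁
    have hω := eq_sub_of_add_eq pullback_absOmega
    simp only [map_add, map_sub, map_neg, pullback_smul, pullback_D, map_mul, map_pow,
      AlgHom.coe_restrictScalars', AlgHom.commutes, res₂_x, res₂_y, Derivation.leibniz,
      Derivation.leibniz_pow, D_xinv_abs, hω, hp₁, hq₁]
    match_scalars
    · linear_combination
        (-(algebraMap Base Overlap invDisc * algebraMap Base Overlap t * res₁ y * xinv ^ 2)) * hr +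
        algebraMap Base Overlap invDisc * (res₁ y ^ 3 * (res₁ x * xinv - 1) +
          algebraMap Base Overlap t * res₁ y * (res₁ x * (1 + xinv * res₁ x) -
            3 * algebraMap Base Overlap t * res₁ y * xinv)) * h1
    · linear_combination xinv ^ 2 * res₁ y * hr -
        (-(2 * algebraMap Base Overlap t * xinv * res₁ y ^ 2) +
          res₁ x * res₁ y * (res₁ x * xinv - 1)) * h1

/-! ### The Gauss–Manin connection -/

theorem exists_isGaussManin (c : HesseH1) :
    ∃ s : Ω[Base⁄ℂ] ⊗[Base] HesseH1, IsGaussManin ℂ res₁ res₂ c s := by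
  obtain ⟨a, b, rfl⟩ := exists_eq_smul_classes c
  exact ⟨_, (isGaussManin_omegaClass.smul a).add (isGaussManin_etaClass.smul b)⟩

end HesseFamily

end

open HesseFamily CechDeRham in
theorem corollary2p4 :
    ∃ (e : Module.Basis (Fin 2) Base HesseH1) (nabla : HesseH1 →+ Ω[Base⁄ℂ] ⊗[Base] HesseH1),
      e 0 = omegaClass ∧ e 1 = etaClass ∧
      (∀ c s, IsGaussManin ℂ res₁ res₂ c s ↔ s = nabla c) ∧
      (∀ (a : Base) (c : HesseH1),
        nabla (a • c) = KaehlerDifferential.D ℂ Base a ⊗ₜ[Base] c + a • nabla c) ∧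
      ∀ j, nabla (e j) =
        dtOverDisc ⊗ₜ[Base] ∑ i, (!![t ^ 2, t; -1, -t ^ 2] : Matrix (Fin 2) (Fin 2) Base) i j • e i := by
  obtain ⟨e, he0, he1⟩ := exists_basis
  choose f hf using exists_isGaussManin
  refine ⟨e, AddMonoidHom.mk' f fun c c' => isGaussManin_unique (hf _) ((hf c).add (hf c')),
    he0, he1, fun c s => ⟨fun h => isGaussManin_unique h (hf c), ?_⟩,
    fun a c => isGaussManin_unique (hf _) ((hf c).smul a), ?_⟩
  · rintro rfl
    exact hf c
  · rw [Fin.forall_fin_two]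
    simp only [Fin.sum_univ_two, he0, he1]
    exact ⟨isGaussManin_unique (hf _) isGaussManin_omegaClass,
      isGaussManin_unique (hf _) isGaussManin_etaClass⟩
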